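/- **Theorem (Almost sure convergence of joint dual averaging with adaptive importance sampling).** *Setting.* Let $\Theta=\{\theta\in\mathbb R^s: A\theta\le b\}$ and $\mathcal M=\{\mu\in\mathbb R^m: C\mu\le d\}$ be polyhedra, let $\mathbb P$ be a probability distribution on $\mathbb R^r$, and let $f(\theta)=\mathbb E_{X\sim\mathbb P}[F(\theta,X)]$, with stochastic gradient $G(\theta,x)=\nabla_\theta F(\theta,x)$, so that $\nabla f(\theta)=\mathbb E_{X\sim\mathbb P}[G(\theta,X)]$ on $\Theta$. Let $(\mathbb P_\mu)_{\mu\in\mathcal M}$ be a family of probability distributions with $\mathbb P\ll\mathbb P_\mu$ and likelihood ratio $\ell(x,\mu)=\frac{d\mathbb P}{d\mathbb P_\mu}(x)$, such that for every $x$ the function $\mu\mapsto\ell(x,\mu)$ is logarithmically convex and differentiable on $\mathcal M$. For $\theta\in\Theta$ let $\mathrm P_{\theta}$ be the orthogonal projector onto the null space of the rows of $A$ whose constraints are active at $\theta$, and set $$G_\mu(\theta,x)=\ell(x,\mu)\,G(\theta,x),\qquad v(\theta,\mu)=\mathbb E_{X\sim\mathbb P}\big[\|\mathrm P_\theta G(\theta,X)\|^2\,\ell(X,\mu)\big],\qquad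 H(\theta,\mu,x)=\|\mathrm P_\theta G(\theta,x)\|^2\,\nabla_\mu\ell(x,\mu),$$ so that $\nabla_\mu v(\theta,\mu)=\mathbb E_{X\sim\mathbb P}[H(\theta,\mu,X)]$. *Algorithm.* Let $\alpha_n=\alpha n^{-\gamma}$ with $\alpha>0$ and $\gamma\in(1/2,1)$, and let $(\theta_0,\mu_0)\in\Theta\times\mathcal M$. For $n\ge 0$ put $$(\theta_{n+1},\mu_{n+1})=\operatorname*{arg\,min}_{(\theta,\mu)\in\Theta\times\mathcal M}\Big\{\sum_{k=0}^n\alpha_{k+1}\big(\langle G_{\mu_k}(\theta_k,X^{(\mu_k)}_{k+1}),\theta\rangle+\langle H(\theta_k,\mu_k,X_{k+1}),\mu\rangle\big)+\tfrac12\|\theta-\theta_0\|^2+\tfrac12\|\mu-\mu_0\|^2\Big\},$$ where, conditionally on the past up to time $k$, the sample $X^{(\mu_k)}_{k+1}$ has law $\mathbb P_{\mu_k}$ and the sample $X_{k+1}$ has law $\mathbb P$. *Assumptions.* 1. $f$ is convex and continuously differentiable on $\Theta$; the problem $\min_{\theta\in\Theta}f(\theta)$ has a unique minimizer $\theta^\star$;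 $f$ is twice continuously differentiable near $\theta^\star$, and $\nabla^2f(\theta^\star)$ is positive definite; $\Theta$ is bounded. 2. The problem $\min_{\mu\in\mathcal M}v(\theta^\star,\mu)$ has a unique minimizer $\mu^\star$, and $\nabla^2_\mu v(\theta^\star,\mu^\star)$ is positive definite; $\mathcal M$ is bounded; and there are constants $G_M,H_M<\infty$ such that $\mathbb E_{X\sim\mathbb P}[\|G(\theta,X)\|^2\ell(X,\mu)]\le G_M^2$ and $\mathbb E_{X\sim\mathbb P}[\|\mathrm P_\theta G(\theta,X)\|^4\|\nabla_\mu\ell(X,\mu)\|^2]\le H_M^2$ for all $\theta\in\Theta$ and $\mu\in\mathcal M$. 3. There are constants $c_1>0$ and $c_2,c_3<\infty$ such that - $f(\theta)-f(\theta^\star)\ge c_1\|\theta-\theta^\star\|^2$ and $v(\theta^\star,\mu)-v(\theta^\star,\mu^\star)\ge c_1\|\mu-\mu^\star\|^2$ for all $\theta\in\Theta$, $\mu\in\mathcal M$; - $\|\nabla f(\theta)-\nabla f(\theta^\star)\|\le c_2\|\theta-\theta^\star\|$ and $\|\nabla_\mu v(\theta^\star,\mu)-\nabla_\mu v(\theta^\star,\mu^\star)\|\le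 c_2\|\mu-\mu^\star\|$ for all $\theta\in\Theta$, $\mu\in\mathcal M$; - $\|\nabla_\mu v(\theta,\mu)-\nabla_\mu v(\theta^\star,\mu)\|\le c_3\|\theta-\theta^\star\|^2$ for all $\mu\in\mathcal M$ and all $\theta\in\Theta$ at which exactly the constraints active at $\theta^\star$ are active; - $-\nabla f(\theta^\star)=\sum_i\lambda_i A_i^\top$, where the sum is over the rows $A_i$ of $A$ active at $\theta^\star$ and all these $\lambda_i$ are strictly positive. *Conclusion.* Then $(\theta_n,\mu_n)\to(\theta^\star,\mu^\star)$ almost surely. -/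

import Mathlib

open MeasureTheory ProbabilityTheory Filter Topology
open scoped Matrix

namespace JointNDA

noncomputable section

/-- `ℝⁿ` with its Euclidean norm and inner product. -/
abbrev Vec (n : ℕ) := EuclideanSpace ℝ (Fin n)

/-! ### Polyhedra and active constraints -/

/-- The polyhedron `{x : A x ≤ b}`. -/
def polyhedron {k n : ℕ} (A : Matrix (Fin k) (Fin n) ℝ) (b : Fin k → ℝ) : Set (Vec n) :=
  {x | ∀ i, (A *ᵥ x.ofLp) i ≤ b i}

/-- The set of (indices of the) constraints that are active at `x`. -/
def activeSet {k n : ℕ} (A : Matrix (Fin k) (Fin n) ℝ) (b : Fin k → ℝ) (x : Vec n) :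
    Set (Fin k) :=
  {i | (A *ᵥ x.ofLp) i = b i}

/-- The null space of the rows of `A` that are active at `x`. -/
def activeKer {k n : ℕ} (A : Matrix (Fin k) (Fin n) ℝ) (b : Fin k → ℝ) (x : Vec n) :
    Submodule ℝ (Vec n) where
  carrier := {u | ∀ i ∈ activeSet A b x, (A *ᵥ u.ofLp) i = 0}
  add_mem' := by
    intro u w hu hw i hi
    simp [Matrix.mulVec_add, hu i hi, hw i hi]
  zero_mem' := by
    intro i _
    simp
  smul_mem' := by
    intro c u hu i hi
    simp [Matrix.mulVec_smul, hu i hi]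

/-- The orthogonal projector onto the null space of the constraints active at `x`. -/
def activeProj {k n : ℕ} (A : Matrix (Fin k) (Fin n) ℝ) (b : Fin k → ℝ) (x : Vec n) :
    Vec n →L[ℝ] Vec n :=
  (activeKer A b x).starProjection

/-! ### Generic notions -/

/-- `x` is the unique minimizer of `g` over `K`. -/
def IsUniqueMinimizer {α : Type*} (g : α → ℝ) (K : Set α) (x : α) : Prop :=
  x ∈ K ∧ IsMinOn g K x ∧ ∀ y ∈ K, IsMinOn g K y → y = x

/-- Symmetric positive definite linear maps of `ℝⁿ`. -/
def IsSymmPosDef {n : ℕ} (Q : Vec n →L[ℝ] Vec n) : Prop :=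
  (∀ u w, inner ℝ (Q u) w = inner ℝ u (Q w)) ∧ ∀ u, u ≠ 0 → 0 < inner ℝ (Q u) u

/-- Logarithmic convexity on `K` of a nonnegative function (which may vanish), that is, convexity
of its logarithm with the convention `log 0 = -∞`. -/
def LogConvexOn {n : ℕ} (K : Set (Vec n)) (g : Vec n → ℝ) : Prop :=
  (∀ x ∈ K, 0 ≤ g x) ∧
    ∀ x ∈ K, ∀ y ∈ K, ∀ a b : ℝ, 0 ≤ a → 0 ≤ b → a + b = 1 →
      g (a • x + b • y) ≤ g x ^ a * g y ^ b

/-! ### The stochastic program and the importance sampling family -/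

/-- A stochastic program `min {𝔼 F(θ, X) : A θ ≤ b}`, `X ∼ P`, on `ℝˢ`, with data in `ℝʳ`, together
with a family of importance sampling distributions `Pμ`, indexed by `μ ∈ M = {μ : C μ ≤ d} ⊆ ℝᵐ`,
and its likelihood ratios. Values of `Pμ` and `ℓ` at parameters outside `M` play no role, except
that `ℓ(x, ·)` is defined around the points of `M`, so that its gradient at these points makes
sense. -/
structure Problem (s r m p q : ℕ) where
  /-- the technology matrix of the decision set -/
  A : Matrix (Fin p) (Fin s) ℝ
  /-- the budget vector of the decision set -/
  b : Fin p → ℝ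
  /-- the technology matrix of the set of importance sampling parameters -/
  C : Matrix (Fin q) (Fin m) ℝ
  /-- the budget vector of the set of importance sampling parameters -/
  d : Fin q → ℝ
  /-- the stochastic objective -/
  F : Vec s → Vec r → ℝ
  /-- the stochastic gradient -/
  G : Vec s → Vec r → Vec s
  /-- the original distribution -/
  P : Measure (Vec r)
  /-- the importance sampling distributions -/
  Pμ : Kernel (Vec m) (Vec r)
  /-- the likelihood ratio `ℓ(x, μ) = dP/dPμ (x)` -/
  ℓ : Vec r → Vec m → ℝ
  isProb : IsProbabilityMeasure P
  isProb_Pμ : ∀ μ ∈ polyhedron C d, IsProbabilityMeasure (Pμ μ)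
  integrable_F : ∀ θ ∈ polyhedron A b, Integrable (F θ) P
  /-- `G(θ, ·) = ∇_θ F(θ, ·)` almost surely -/
  hasGradientAt_F : ∀ θ ∈ polyhedron A b, ∀ᵐ x ∂P, HasGradientAt (fun θ' => F θ' x) (G θ x) θ
  measurable_G : Measurable fun z : Vec s × Vec r => G z.1 z.2
  absCont : ∀ μ ∈ polyhedron C d, P ≪ Pμ μ
  nonneg_ℓ : ∀ x, ∀ μ ∈ polyhedron C d, 0 ≤ ℓ x μ
  density : ∀ μ ∈ polyhedron C d, (fun x => ENNReal.ofReal (ℓ x μ)) =ᵐ[Pμ μ] P.rnDeriv (Pμ μ)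
  measurable_ℓ : Measurable fun z : Vec r × polyhedron C d => ℓ z.1 z.2
  measurable_gradient_ℓ :
    Measurable fun z : Vec r × polyhedron C d => gradient (ℓ z.1) (z.2 : Vec m)

namespace Problem

variable {s r m p q : ℕ} (S : Problem s r m p q)

/-- The feasible set of decisions. -/
def Θ : Set (Vec s) := polyhedron S.A S.b

/-- The set of importance sampling parameters. -/
def M : Set (Vec m) := polyhedron S.C S.d

/-- The objective `f(θ) = 𝔼[F(θ, X)]`, `X ∼ P`. -/
def f (θ : Vec s) : ℝ := ∫ x, S.F θ x ∂S.P

/-- The mean `𝔼[G(θ, X)]`, `X ∼ P`, of the stochastic gradient; it is the gradient of `f` at `θ`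
by `SOAssumption.gradient_f`. -/
def gradf (θ : Vec s) : Vec s := ∫ x, S.G θ x ∂S.P

/-- The projector onto the null space of the constraints of `Θ` that are active at `θ`. -/
def proj (θ : Vec s) : Vec s →L[ℝ] Vec s := activeProj S.A S.b θ

/-- `V(θ, μ, x) = ‖P_θ G(θ, x)‖² ℓ(x, μ)`. -/
def V (θ : Vec s) (μ : Vec m) (x : Vec r) : ℝ := ‖S.proj θ (S.G θ x)‖ ^ 2 * S.ℓ x μ

/-- `v(θ, μ) = 𝔼[V(θ, μ, X)]`, `X ∼ P`. -/
def v (θ : Vec s) (μ : Vec m) : ℝ := ∫ x, S.V θ μ x ∂S.P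

/-- The importance sampling gradient `G_μ(θ, x) = ℓ(x, μ) G(θ, x)`. -/
def Gis (θ : Vec s) (μ : Vec m) (x : Vec r) : Vec s := S.ℓ x μ • S.G θ x

/-- `H(θ, μ, x) = ‖P_θ G(θ, x)‖² ∇_μ ℓ(x, μ)`. -/
def H (θ : Vec s) (μ : Vec m) (x : Vec r) : Vec m :=
  ‖S.proj θ (S.G θ x)‖ ^ 2 • gradient (S.ℓ x) μ

/-- The gradient `∇_μ v(θ, μ) = 𝔼[H(θ, μ, X)]`, `X ∼ P`; that it is the gradient of the
restriction of `v(θ, ·)` to `M` is `hasGradientWithinAt_v` below. -/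
def gradv (θ : Vec s) (μ : Vec m) : Vec m := ∫ x, S.H θ μ x ∂S.P

/-! ### The assumptions -/

/-- Assumptions on the stochastic program; `θstar` is its solution. -/
structure SOAssumption (θstar : Vec s) : Prop where
  convex : ConvexOn ℝ S.Θ S.f
  /-- `f` is differentiable on `Θ`, and its gradient is the mean of the stochastic gradient -/
  gradient_f : ∀ θ ∈ S.Θ, HasGradientWithinAt S.f (S.gradf θ) S.Θ θ
  continuous_gradf : ContinuousOn S.gradf S.Θ
  unique : IsUniqueMinimizer S.f S.Θ θstar
  /-- `f` is twice continuously differentiable near `θstar`, with Hessian in `𝕊₊₊` at `θstar` -/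
  hessian : ∃ U : Set (Vec s), IsOpen U ∧ θstar ∈ U ∧ ∃ Q : Vec s → Vec s →L[ℝ] Vec s,
    (∀ θ ∈ U ∩ S.Θ, HasFDerivWithinAt S.gradf (Q θ) S.Θ θ) ∧
      ContinuousOn Q (U ∩ S.Θ) ∧ IsSymmPosDef (Q θstar)
  bounded : Bornology.IsBounded S.Θ

/-- Regularity of the likelihood ratio in the importance sampling parameter. -/
structure LikelihoodAssumption : Prop where
  logConvex : ∀ x, LogConvexOn S.M (S.ℓ x)
  differentiable : ∀ x, ∀ μ ∈ S.M, DifferentiableAt ℝ (S.ℓ x) μ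

/-- Bounds on the second moments of the two stochastic gradients. -/
structure MomentAssumption : Prop where
  boundG : ∃ GM : ℝ, ∀ θ ∈ S.Θ, ∀ μ ∈ S.M,
    Integrable (fun x => ‖S.G θ x‖ ^ 2 * S.ℓ x μ) S.P ∧
      ∫ x, ‖S.G θ x‖ ^ 2 * S.ℓ x μ ∂S.P ≤ GM ^ 2
  boundH : ∃ HM : ℝ, ∀ θ ∈ S.Θ, ∀ μ ∈ S.M,
    Integrable (fun x => ‖S.proj θ (S.G θ x)‖ ^ 4 * ‖gradient (S.ℓ x) μ‖ ^ 2) S.P ∧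
      ∫ x, ‖S.proj θ (S.G θ x)‖ ^ 4 * ‖gradient (S.ℓ x) μ‖ ^ 2 ∂S.P ≤ HM ^ 2

/-- Assumptions on the importance sampling problem; `μstar` is the optimal parameter. -/
structure ISAssumption (θstar : Vec s) (μstar : Vec m) : Prop where
  unique : IsUniqueMinimizer (S.v θstar) S.M μstar
  hessian : ∃ Q : Vec m →L[ℝ] Vec m,
    HasFDerivWithinAt (S.gradv θstar) Q S.M μstar ∧ IsSymmPosDef Q
  bounded : Bornology.IsBounded S.M
  moment : S.MomentAssumption

/-- Growth, gradient and coupling conditions. -/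
structure RegularityAssumption (θstar : Vec s) (μstar : Vec m) : Prop where
  growth : ∃ c₁ : ℝ, 0 < c₁ ∧
    (∀ θ ∈ S.Θ, c₁ * ‖θ - θstar‖ ^ 2 ≤ S.f θ - S.f θstar) ∧
    (∀ μ ∈ S.M, c₁ * ‖μ - μstar‖ ^ 2 ≤ S.v θstar μ - S.v θstar μstar)
  lipschitz : ∃ c₂ : ℝ,
    (∀ θ ∈ S.Θ, ‖S.gradf θ - S.gradf θstar‖ ≤ c₂ * ‖θ - θstar‖) ∧
    (∀ μ ∈ S.M, ‖S.gradv θstar μ - S.gradv θstar μstar‖ ≤ c₂ * ‖μ - μstar‖)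
  /-- the coupling condition, at all decisions with the same active constraints as `θstar` -/
  coupling : ∃ c₃ : ℝ, ∀ μ ∈ S.M, ∀ θ ∈ S.Θ,
    activeSet S.A S.b θ = activeSet S.A S.b θstar →
      ‖S.gradv θ μ - S.gradv θstar μ‖ ≤ c₃ * ‖θ - θstar‖ ^ 2
  /-- strictly positive multipliers of the active constraints -/
  multipliers : ∃ lam : Fin p → ℝ,
    (∀ i ∈ activeSet S.A S.b θstar, 0 < lam i) ∧
    (∀ i ∉ activeSet S.A S.b θstar, lam i = 0) ∧
    (-S.gradf θstar).ofLp = S.Aᵀ *ᵥ lam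

/-! ### The algorithm -/

/-- The step size `α / nᵞ`. -/
def step (α γ : ℝ) (n : ℕ) : ℝ := α / (n : ℝ) ^ γ

variable {Ω : Type*} {mΩ : MeasurableSpace Ω}

/-- The samples: given the past `ℱ n`, `Xis (n + 1)` has the law `Pμ (μ n)` and `X (n + 1)` has
the law `P`. The values `X 0` and `Xis 0` are not used. -/
structure IsSampling (Pr : Measure Ω) (ℱ : Filtration ℕ mΩ) (μ : ℕ → Ω → Vec m)
    (Xis X : ℕ → Ω → Vec r) : Prop where
  measurable_Xis : ∀ n, Measurable[ℱ (n + 1)] (Xis (n + 1))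
  measurable_X : ∀ n, Measurable[ℱ (n + 1)] (X (n + 1))
  law_Xis : ∀ n, ∀ B : Set (Vec r), MeasurableSet B →
    Pr⟦Xis (n + 1) ⁻¹' B | ℱ n⟧ =ᵐ[Pr] fun ω => (S.Pμ (μ n ω)).real B
  law_X : ∀ n, ∀ B : Set (Vec r), MeasurableSet B →
    Pr⟦X (n + 1) ⁻¹' B | ℱ n⟧ =ᵐ[Pr] fun _ => S.P.real B

/-- The function of `(θ', μ')` minimized in step `n` of joint dual averaging,
`⟪(g, h), (θ', μ')⟫ + ‖(θ' - θ₀, μ' - μ₀)‖² / 2`, where `(g, h)` is the weighted sum of the past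
stochastic gradients. -/
def ndaObjective (α γ : ℝ) (θ : ℕ → Ω → Vec s) (μ : ℕ → Ω → Vec m) (Xis X : ℕ → Ω → Vec r)
    (n : ℕ) (ω : Ω) (z : Vec s × Vec m) : ℝ :=
  inner ℝ (∑ k ∈ Finset.range (n + 1),
      step α γ (k + 1) • S.Gis (θ k ω) (μ k ω) (Xis (k + 1) ω)) z.1
    + inner ℝ (∑ k ∈ Finset.range (n + 1),
      step α γ (k + 1) • S.H (θ k ω) (μ k ω) (X (k + 1) ω)) z.2
    + (‖z.1 - θ 0 ω‖ ^ 2 + ‖z.2 - μ 0 ω‖ ^ 2) / 2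

/-- The joint Nesterov dual averaging iteration, started at `(θ₀, μ₀)`. -/
structure IsJointNDA (α γ : ℝ) (θ₀ : Vec s) (μ₀ : Vec m) (θ : ℕ → Ω → Vec s)
    (μ : ℕ → Ω → Vec m) (Xis X : ℕ → Ω → Vec r) : Prop where
  init : ∀ ω, θ 0 ω = θ₀ ∧ μ 0 ω = μ₀
  mem : ∀ n ω, (θ (n + 1) ω, μ (n + 1) ω) ∈ S.Θ ×ˢ S.M
  argmin : ∀ n ω, IsMinOn (S.ndaObjective α γ θ μ Xis X n ω) (S.Θ ×ˢ S.M)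
    (θ (n + 1) ω, μ (n + 1) ω)

end Problem

/-! ### `gradv` is the gradient of `v` -/

section Polytope

variable {k n : ℕ} {A : Matrix (Fin k) (Fin n) ℝ} {b : Fin k → ℝ}

theorem mulVec_segment (x y : Vec n) (t : ℝ) (i : Fin k) :
    (A *ᵥ (x + t • (y - x)).ofLp) i
      = (A *ᵥ x.ofLp) i + t * ((A *ᵥ y.ofLp) i - (A *ᵥ x.ofLp) i) := by
  simp [Matrix.mulVec_add, Matrix.mulVec_smul, Matrix.mulVec_sub]

theorem isClosed_polyhedron : IsClosed (polyhedron A b) := by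
  have : polyhedron A b = ⋂ i, {x : Vec n | (A *ᵥ x.ofLp) i ≤ b i} := by
    ext x; simp [polyhedron]
  rw [this]
  refine isClosed_iInter fun i => isClosed_le ?_ continuous_const
  simp only [Matrix.mulVec, dotProduct]
  fun_prop

theorem convex_polyhedron : Convex ℝ (polyhedron A b) := by
  intro x hx y hy a c ha hc hac i
  have h1 := mul_le_mul_of_nonneg_left (hx i) ha
  have h2 := mul_le_mul_of_nonneg_left (hy i) hc
  have h3 : (A *ᵥ (a • x + c • y).ofLp) i = a * (A *ᵥ x.ofLp) i + c * (A *ᵥ y.ofLp) i := by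
    simp [Matrix.mulVec_add, Matrix.mulVec_smul]
  have h4 : a * b i + c * b i = b i := by rw [← add_mul, hac, one_mul]
  linarith

/-- Feasible directions can be followed for a uniform positive time. -/
theorem exists_step {x : Vec n} (hx : x ∈ polyhedron A b) :
    ∃ δ > 0, ∀ y ∈ polyhedron A b, ∀ t : ℝ, 0 ≤ t → t * ‖y - x‖ ≤ δ →
      x + t • (y - x) ∈ polyhedron A b := by
  have key : ∀ i, ∃ δ > 0, ∀ y ∈ polyhedron A b, ∀ t : ℝ, 0 ≤ t → t * ‖y - x‖ ≤ δ →
      (A *ᵥ (x + t • (y - x)).ofLp) i ≤ b i := by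
    intro i
    rcases (hx i).eq_or_lt with h | h
    · refine ⟨1, one_pos, fun y hy t ht _ => ?_⟩
      rw [mulVec_segment, h]
      have : t * ((A *ᵥ y.ofLp) i - b i) ≤ 0 :=
        mul_nonpos_of_nonneg_of_nonpos ht (sub_nonpos.2 (hy i))
      linarith
    · have hcont : Continuous fun z : Vec n => (A *ᵥ z.ofLp) i := by
        simp only [Matrix.mulVec, dotProduct]
        fun_prop
      have hev : ∀ᶠ z in 𝓝 x, (A *ᵥ z.ofLp) i < b i :=
        hcont.continuousAt.eventually_lt continuousAt_const h
      obtain ⟨ε, hε, hball⟩ := Metric.eventually_nhds_iff.1 hev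
      refine ⟨ε / 2, half_pos hε, fun y _ t ht hty => (hball ?_).le⟩
      rw [dist_eq_norm, add_sub_cancel_left, norm_smul, Real.norm_of_nonneg ht]
      linarith
  choose δ hδ hδ' using key
  rcases isEmpty_or_nonempty (Fin k) with h | h
  · exact ⟨1, one_pos, fun y _ t _ _ i => (h.false i).elim⟩
  · obtain ⟨j, hj⟩ := Finite.exists_min δ
    exact ⟨δ j, hδ j, fun y hy t ht hty i => hδ' i y hy t ht (hty.trans (hj i))⟩

/-- A point of a polyhedron that has at least the same active constraints as an extreme point
is equal to that point. -/
theorem extreme_unique {x y : Vec n} (hx : x ∈ (polyhedron A b).extremePoints ℝ)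
    (hy : y ∈ polyhedron A b) (hxy : activeSet A b x ⊆ activeSet A b y) : y = x := by
  by_contra hne
  have hev : ∀ᶠ t : ℝ in 𝓝[>] 0, ∀ i, (A *ᵥ (x + (-t) • (y - x)).ofLp) i ≤ b i := by
    refine eventually_all.2 fun i => ?_
    rcases (hx.1 i).eq_or_lt with h | h
    · refine Eventually.of_forall fun t => ?_
      have h2 : (A *ᵥ y.ofLp) i = b i := hxy h
      rw [mulVec_segment, h, h2]; simp
    · have hc : Continuous fun t : ℝ =>
          (A *ᵥ x.ofLp) i + (-t) * ((A *ᵥ y.ofLp) i - (A *ᵥ x.ofLp) i) := by fun_prop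
      have := hc.continuousAt (x := 0).eventually_lt
        (continuousAt_const (y := b i)) (by simpa using h)
      filter_upwards [this.filter_mono nhdsWithin_le_nhds] with t ht
      rw [mulVec_segment]; exact ht.le
  obtain ⟨t, ht, ht0⟩ := (hev.and self_mem_nhdsWithin).exists
  have ht0 : 0 < t := ht0
  have hmem : x ∈ openSegment ℝ (x + (-t) • (y - x)) y := by
    refine ⟨1 / (1 + t), t / (1 + t), by positivity, by positivity, by field_simp, ?_⟩
    have h1 : (1 + t) ≠ 0 := by positivity
    have : (1 / (1 + t)) • (x + (-t) • (y - x)) + (t / (1 + t)) • y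
        = ((1 / (1 + t)) * (1 + t)) • x + (-(1 / (1 + t) * t) + t / (1 + t)) • y := by module
    rw [this, show -(1 / (1 + t) * t) + t / (1 + t) = 0 by ring, one_div_mul_cancel h1]
    simp
  have h0 : (-t) • (y - x) = 0 := by simpa using hx.2 ht hy hmem
  rcases smul_eq_zero.1 h0 with h | h
  · linarith
  · exact hne (sub_eq_zero.1 h)

theorem finite_extremePoints : ((polyhedron A b).extremePoints ℝ).Finite := by
  refine Set.Finite.of_finite_image (f := activeSet A b) (Set.toFinite _) ?_
  intro x hx y hy hxy
  exact (extreme_unique hx hy.1 hxy.le).symm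

theorem exists_vertices (hb : Bornology.IsBounded (polyhedron A b)) :
    ∃ W : Finset (Vec n), (W : Set (Vec n)) ⊆ polyhedron A b ∧
      polyhedron A b ⊆ convexHull ℝ (W : Set (Vec n)) := by
  have hcomp : IsCompact (polyhedron A b) :=
    Metric.isCompact_of_isClosed_isBounded isClosed_polyhedron hb
  have hfin : ((polyhedron A b).extremePoints ℝ).Finite := finite_extremePoints
  refine ⟨hfin.toFinset, by simpa using extremePoints_subset, ?_⟩
  rw [hfin.coe_toFinset]
  have := closure_convexHull_extremePoints hcomp convex_polyhedron
  rw [(hfin.isCompact_convexHull ℝ).isClosed.closure_eq] at this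
  exact this.ge

end Polytope

theorem LogConvexOn.convexOn {n : ℕ} {K : Set (Vec n)} {g : Vec n → ℝ} (hK : Convex ℝ K)
    (h : LogConvexOn K g) : ConvexOn ℝ K g := by
  refine ⟨hK, fun x hx y hy a c ha hc hac => (h.2 x hx y hy a c ha hc hac).trans ?_⟩
  simpa using Real.geom_mean_le_arith_mean2_weighted ha hc (h.1 x hx) (h.1 y hy) hac

/-- First order lower bound for a convex function. -/
theorem convexOn_gradient_le {n : ℕ} {K : Set (Vec n)} {g : Vec n → ℝ} (h : ConvexOn ℝ K g)
    {x y g' : Vec n} (hx : x ∈ K) (hy : y ∈ K) (hg : HasGradientAt g g' x) :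
    0 ≤ g y - g x - inner ℝ g' (y - x) := by
  have hline : HasDerivAt (fun t : ℝ => g (x + t • (y - x))) (inner ℝ g' (y - x)) 0 := by
    have h1 : HasDerivAt (fun t : ℝ => x + t • (y - x)) (y - x) 0 := by
      simpa using ((hasDerivAt_id (0 : ℝ)).smul_const (y - x)).const_add x
    have h2 : HasFDerivAt g (InnerProductSpace.toDual ℝ (Vec n) g') (x + (0 : ℝ) • (y - x)) := by
      simpa using hg.hasFDerivAt
    have h3 := h2.comp_hasDerivAt (0 : ℝ) h1
    rw [InnerProductSpace.toDual_apply_apply] at h3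
    exact h3
  have hslope := hline.tendsto_slope.mono_left
    (nhdsWithin_mono (0 : ℝ) (fun t (ht : 0 < t) => ht.ne') : 𝓝[>] (0 : ℝ) ≤ _)
  have hle : inner ℝ g' (y - x) ≤ g y - g x := by
    refine le_of_tendsto hslope ?_
    filter_upwards [Ioo_mem_nhdsGT (zero_lt_one (α := ℝ))] with t ht
    have hc := h.2 hx hy (sub_nonneg.2 ht.2.le) ht.1.le (by ring)
    have he : x + t • (y - x) = (1 - t) • x + t • y := by module
    rw [slope_def_field, he, div_le_iff₀ (by linarith [ht.1])]
    simp only [smul_eq_mul, zero_smul, add_zero, sub_zero] at hc ⊢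
    linarith
  linarith

namespace Problem

variable {s r m p q : ℕ} (S : Problem s r m p q)

theorem measurable_projG (θ : Vec s) : Measurable fun x => S.proj θ (S.G θ x) :=
  (S.proj θ).continuous.measurable.comp (S.measurable_G.comp measurable_prodMk_left)

theorem integrable_V (hM : S.MomentAssumption) {θ : Vec s} (hθ : θ ∈ S.Θ) {μ : Vec m}
    (hμ : μ ∈ S.M) : Integrable (S.V θ μ) S.P := by
  obtain ⟨GM, hG⟩ := hM.boundG
  have hℓ : Measurable fun x => S.ℓ x μ :=
    S.measurable_ℓ.comp (measurable_prodMk_right (y := (⟨μ, hμ⟩ : polyhedron S.C S.d)))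
  refine (hG θ hθ μ hμ).1.mono'
    (((S.measurable_projG θ).norm.pow_const 2).mul hℓ).aestronglyMeasurable (ae_of_all _ ?_)
  intro x
  have h0 := S.nonneg_ℓ x μ hμ
  rw [Real.norm_of_nonneg (by unfold V; positivity)]
  unfold V
  gcongr
  exact Submodule.norm_starProjection_apply_le _ _

theorem integrable_H (hM : S.MomentAssumption) {θ : Vec s} (hθ : θ ∈ S.Θ) {μ : Vec m}
    (hμ : μ ∈ S.M) : Integrable (S.H θ μ) S.P := by
  have := S.isProb
  obtain ⟨HM, hH⟩ := hM.boundH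
  have hD : Measurable fun x => gradient (S.ℓ x) μ :=
    S.measurable_gradient_ℓ.comp (measurable_prodMk_right (y := (⟨μ, hμ⟩ : polyhedron S.C S.d)))
  have hmeas : AEStronglyMeasurable (S.H θ μ) S.P :=
    (((S.measurable_projG θ).norm.pow_const 2).smul hD).aestronglyMeasurable
  have h2 : MemLp (S.H θ μ) 2 S.P := by
    refine (memLp_two_iff_integrable_sq_norm hmeas).2 ((hH θ hθ μ hμ).1.congr (ae_of_all _ ?_))
    intro x
    simp only [H, norm_smul, norm_pow, norm_norm]
    ring
  exact h2.integrable (by norm_num)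

/-- The gradient of the restriction of `v(θ, ·)` to the polytope `M` is `𝔼[H(θ, ·, X)]`. -/
theorem hasGradientWithinAt_v (hL : S.LikelihoodAssumption) (hM : S.MomentAssumption)
    (hb : Bornology.IsBounded S.M) {θ : Vec s} (hθ : θ ∈ S.Θ) {μ : Vec m} (hμ : μ ∈ S.M) :
    HasGradientWithinAt (S.v θ) (S.gradv θ μ) S.M μ := by
  have := S.isProb
  obtain ⟨δ, hδ, hstep⟩ := exists_step (A := S.C) (b := S.d) hμ
  obtain ⟨W, hWM, hW⟩ := exists_vertices (A := S.C) (b := S.d) hb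
  have hconv : ∀ x, ConvexOn ℝ S.M (S.ℓ x) := fun x =>
    (hL.logConvex x).convexOn convex_polyhedron
  have hgrad : ∀ x, HasGradientAt (S.ℓ x) (gradient (S.ℓ x) μ) μ := fun x =>
    (hL.differentiable x μ hμ).hasGradientAt
  -- the first order remainder of the likelihood ratio, and its weighted version
  let ρ : Vec r → Vec m → ℝ := fun x y =>
    S.ℓ x y - S.ℓ x μ - inner ℝ (gradient (S.ℓ x) μ) (y - μ)
  let w : Vec r → ℝ := fun x => ‖S.proj θ (S.G θ x)‖ ^ 2
  have hw : ∀ x, 0 ≤ w x := fun x => by positivity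
  have hρ0 : ∀ x, ∀ y ∈ S.M, 0 ≤ ρ x y := fun x y hy =>
    convexOn_gradient_le (hconv x) hμ hy (hgrad x)
  have hwρ : ∀ y ∈ S.M, Integrable (fun x => w x * ρ x y) S.P := by
    intro y hy
    have h1 := ((S.integrable_V hM hθ hy).sub (S.integrable_V hM hθ hμ)).sub
      ((S.integrable_H hM hθ hμ).inner_const (𝕜 := ℝ) (y - μ))
    refine h1.congr (ae_of_all _ fun x => ?_)
    simp only [Pi.sub_apply, V, H, inner_smul_left, ρ, w]
    simp only [map_pow, conj_trivial]
    ring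
  have hint : ∀ y ∈ S.M, ∫ x, w x * ρ x y ∂S.P
      = S.v θ y - S.v θ μ - inner ℝ (S.gradv θ μ) (y - μ) := by
    intro y hy
    have hV1 := S.integrable_V hM hθ hy
    have hV2 := S.integrable_V hM hθ hμ
    have hH := S.integrable_H hM hθ hμ
    have e1 : inner ℝ (S.gradv θ μ) (y - μ) = ∫ x, inner ℝ (S.H θ μ x) (y - μ) ∂S.P := by
      rw [real_inner_comm, gradv, ← integral_inner hH]
      simp_rw [real_inner_comm]
    rw [e1, v, v, ← integral_sub hV1 hV2]
    refine Eq.trans ?_ (integral_sub (hV1.sub hV2) (hH.inner_const (𝕜 := ℝ) (y - μ)))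
    refine integral_congr_ae (ae_of_all _ fun x => ?_)
    simp only [V, H, inner_smul_left, ρ, w]
    simp only [map_pow, conj_trivial]
    ring
  have hρconv : ∀ x, ConvexOn ℝ S.M (ρ x) := by
    intro x
    refine ⟨(hconv x).1, fun y hy z hz a c ha hc hac => ?_⟩
    have h1 := (hconv x).2 hy hz ha hc hac
    have h2 : a • y + c • z - μ = a • (y - μ) + c • (z - μ) := by
      have : μ = a • μ + c • μ := by rw [← add_smul, hac, one_smul]
      nth_rewrite 1 [this]
      module
    simp only [ρ, smul_eq_mul] at h1 ⊢
    rw [h2, inner_add_right, inner_smul_right, inner_smul_right]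
    have h3 : S.ℓ x μ = a * S.ℓ x μ + c * S.ℓ x μ := by rw [← add_mul, hac, one_mul]
    linarith
  -- domination of the remainder by its values at the vertices
  have hdom : ∀ x, ∀ y ∈ S.M, ‖y - μ‖ ≤ δ → ‖y - μ‖⁻¹ * ρ x y ≤ δ⁻¹ * ∑ z ∈ W, ρ x z := by
    intro x y hy hyδ
    have hsum0 : 0 ≤ ∑ z ∈ W, ρ x z := Finset.sum_nonneg fun z hz => hρ0 x z (hWM hz)
    rcases eq_or_ne y μ with rfl | hne
    · simp only [sub_self, norm_zero, inv_zero, zero_mul]; positivity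
    have hn : 0 < ‖y - μ‖ := norm_pos_iff.2 (sub_ne_zero.2 hne)
    let y' := μ + (δ / ‖y - μ‖) • (y - μ)
    have hy' : y' ∈ S.M := hstep y hy _ (by positivity) (by field_simp; exact le_rfl)
    have hle : ρ x y' ≤ ∑ z ∈ W, ρ x z := by
      obtain ⟨z, hz, hzle⟩ := (hρconv x).exists_ge_of_mem_convexHull hWM (hW hy')
      exact hzle.trans (Finset.single_le_sum (f := fun z => ρ x z)
        (fun z hz => hρ0 x z (hWM hz)) hz)
    have ht1 : ‖y - μ‖ / δ ≤ 1 := (div_le_one hδ).2 hyδ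
    have hc := (hρconv x).2 hμ hy' (sub_nonneg.2 ht1)
      (show 0 ≤ ‖y - μ‖ / δ by positivity) (by ring)
    have hyy : (1 - ‖y - μ‖ / δ) • μ + (‖y - μ‖ / δ) • y' = y := by
      have h1 : (1 - ‖y - μ‖ / δ) • μ + (‖y - μ‖ / δ) • y'
          = μ + (‖y - μ‖ / δ * (δ / ‖y - μ‖)) • (y - μ) := by simp only [y']; module
      rw [h1, show ‖y - μ‖ / δ * (δ / ‖y - μ‖) = 1 by field_simp]
      simp
    rw [hyy] at hc
    have hρμ : ρ x μ = 0 := by simp [ρ]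
    rw [hρμ, smul_zero, zero_add, smul_eq_mul] at hc
    calc ‖y - μ‖⁻¹ * ρ x y ≤ ‖y - μ‖⁻¹ * (‖y - μ‖ / δ * ρ x y') := by gcongr
      _ = δ⁻¹ * ρ x y' := by field_simp
      _ ≤ _ := by gcongr
  -- dominated convergence
  have hlim : Tendsto (fun y => ∫ x, ‖y - μ‖⁻¹ * (w x * ρ x y) ∂S.P) (𝓝[S.M] μ) (𝓝 0) := by
    have h0 : (0 : ℝ) = ∫ _x, (0 : ℝ) ∂S.P := by simp
    rw [h0]
    refine tendsto_integral_filter_of_dominated_convergence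
      (fun x => δ⁻¹ * ∑ z ∈ W, w x * ρ x z) ?_ ?_ ?_ ?_
    · filter_upwards [self_mem_nhdsWithin] with y hy
      exact ((hwρ y hy).const_mul _).aestronglyMeasurable
    · have hball : ∀ᶠ y in 𝓝[S.M] μ, ‖y - μ‖ ≤ δ := by
        refine Filter.Eventually.filter_mono nhdsWithin_le_nhds ?_
        filter_upwards [Metric.closedBall_mem_nhds μ hδ] with y hy
        simpa [dist_eq_norm] using hy
      filter_upwards [self_mem_nhdsWithin, hball] with y hy hyδ
      refine ae_of_all _ fun x => ?_
      have := hρ0 x y hy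
      rw [Real.norm_of_nonneg (by have := hw x; positivity), ← Finset.mul_sum]
      calc ‖y - μ‖⁻¹ * (w x * ρ x y) = w x * (‖y - μ‖⁻¹ * ρ x y) := by ring
        _ ≤ w x * (δ⁻¹ * ∑ z ∈ W, ρ x z) := by
          have := hdom x y hy hyδ
          have := hw x
          gcongr
        _ = _ := by ring
    · exact (integrable_finsetSum _ fun z hz => hwρ z (hWM hz)).const_mul _
    · refine ae_of_all _ fun x => ?_
      have h1 := hasFDerivAt_iff_tendsto.1 (hgrad x).hasFDerivAt
      have h2 : Tendsto (fun y => w x * (‖y - μ‖⁻¹ * ρ x y)) (𝓝[S.M] μ) (𝓝 (w x * 0)) := by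
        refine Tendsto.const_mul _ ((h1.mono_left nhdsWithin_le_nhds).congr' ?_)
        filter_upwards [self_mem_nhdsWithin] with y hy
        rw [InnerProductSpace.toDual_apply_apply, Real.norm_of_nonneg (hρ0 x y hy)]
      rw [mul_zero] at h2
      refine h2.congr fun y => ?_
      ring
  rw [hasGradientWithinAt_iff_hasFDerivWithinAt, hasFDerivWithinAt_iff_tendsto]
  refine hlim.congr' ?_
  filter_upwards [self_mem_nhdsWithin] with y hy
  rw [integral_const_mul, InnerProductSpace.toDual_apply_apply, ← hint y hy,
    Real.norm_of_nonneg (integral_nonneg fun x => mul_nonneg (hw x) (hρ0 x y hy))]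

end Problem

end

end JointNDA

open JointNDA

/-! The objective separates, so each iterate is the Euclidean projection of its own dual variable
`y`, the starting point minus the weighted sum of past stochastic gradients. The argument is
pathwise on an almost sure event and treats the decision first, then the sampling parameter.

Decision. Importance weights cancel the change of measure, so the stochastic gradient has mean
`gradf θ` whatever `μ` is, with a uniformly bounded second moment. As the squared steps are
summable, the weighted noise is a convergent L²-bounded martingale and the weighted squared norms
are summable. With `x` the projection of `y` and `p` the target, the Lyapunov function is `F = ‖p -
y‖² - ‖x - y‖²`, which dominates `‖x - p‖²`. Quadratic growth makes `F` decrease by a multiple of `a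
‖x - p‖²`, up to summable noise. Hence `F` converges and `∑ a ‖x - p‖²` is finite; since `∑ a`
diverges, `x` returns arbitrarily close to `p`. On a polyhedron `F` equals `‖x - p‖²` near `p`, so
the limit of `F` is zero. This is `dualAveraging_tendsto`.

Identification. The projector `P_θ` jumps between faces, so closeness of `θ` to `θstar` alone does
not control the gradient in `μ`. Strict multipliers help: in a direction `u` from a wrong face to
`p`, `⟪y, u⟫` grows linearly in the sum of the steps, whereas it would have to stay bounded whenever
the iterate lies on that face. So the active set is eventually that of `θstar`
(`dualAveraging_activeSet`).

Parameter. From then on, coupling bounds the bias of the `μ`-gradient by `c₃ ‖θ - θstar‖²`, whose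
weighted sum is finite by the first stage. Since `v θstar` is convex with quadratic growth,
`dualAveraging_tendsto` applies again, with this summable error. -/

namespace JointNDA

/-! ### Samples drawn from a Markov kernel -/

section Sampling

variable {Ω T E : Type*} {m mΩ : MeasurableSpace Ω} [MeasurableSpace T] [MeasurableSpace E]
  {Pr : Measure Ω} [IsProbabilityMeasure Pr] {κ : Kernel T E} [IsMarkovKernel κ]

/-- The joint law of a parameter known at time `m` and of a sample whose conditional law given
`m` is `κ` at this parameter, on an event known at time `m`. -/
theorem map_restrict_eq_compProd (hm : m ≤ mΩ) {Z : Ω → T} {Y : Ω → E}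
    (hZ : Measurable[m] Z) (hY : Measurable Y)
    (hlaw : ∀ B : Set E, MeasurableSet B →
      Pr⟦Y ⁻¹' B | m⟧ =ᵐ[Pr] fun ω => (κ (Z ω)).real B)
    {U : Set Ω} (hU : MeasurableSet[m] U) :
    (Pr.restrict U).map (fun ω => (Z ω, Y ω)) = (Pr.restrict U).map Z ⊗ₘ κ := by
  have hZ' : Measurable Z := hZ.mono hm le_rfl
  have : IsFiniteMeasure ((Pr.restrict U).map fun ω => (Z ω, Y ω)) := inferInstance
  refine Measure.ext_prod fun {V B} hV hB => ?_
  have hUV : MeasurableSet[m] (Z ⁻¹' V ∩ U) := (hZ hV).inter hU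
  rw [Measure.map_apply (hZ'.prodMk hY) (hV.prod hB), Measure.compProd_apply_prod hV hB,
    Measure.restrict_map hZ' hV, lintegral_map (κ.measurable_coe hB) hZ',
    Measure.restrict_restrict (hZ' hV)]
  have h1 : (fun ω => (Z ω, Y ω)) ⁻¹' V ×ˢ B = Y ⁻¹' B ∩ Z ⁻¹' V := by
    ext ω; simp [and_comm]
  rw [h1, Measure.restrict_apply ((hY hB).inter (hZ' hV)), Set.inter_assoc]
  have hint : Integrable ((Y ⁻¹' B).indicator fun _ => (1 : ℝ)) Pr :=
    (integrable_const 1).indicator (hY hB)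
  -- The event `Z ⁻¹' V ∩ U` is known at time `m`, so the conditional law may be integrated over it.
  have h2 := setIntegral_condExp hm hint hUV
  rw [integral_congr_ae (ae_restrict_of_ae (hlaw B hB)), setIntegral_indicator (hY hB)] at h2
  simp only [integral_const, smul_eq_mul, mul_one, measureReal_restrict_apply_univ] at h2
  have h3 : ∫⁻ ω in Z ⁻¹' V ∩ U, κ (Z ω) B ∂Pr
      = ENNReal.ofReal (∫ ω in Z ⁻¹' V ∩ U, (κ (Z ω)).real B ∂Pr) := by
    rw [ofReal_integral_eq_lintegral_ofReal]
    · simp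
    · refine Integrable.of_bound (C := 1)
        (((κ.measurable_coe hB).comp hZ').ennreal_toReal).aestronglyMeasurable (ae_of_all _ ?_)
      intro ω
      rw [Real.norm_of_nonneg measureReal_nonneg]
      exact measureReal_le_one
    · exact ae_of_all _ fun ω => measureReal_nonneg
  rw [h3, h2, ofReal_measureReal, Set.inter_comm]

/-- Disintegration of the joint law: it turns a moment bound uniform over the kernel's parameter
into a bound for the actual samples. -/
theorem lintegral_sample (hm : m ≤ mΩ) {Z : Ω → T} {Y : Ω → E}
    (hZ : Measurable[m] Z) (hY : Measurable Y)
    (hlaw : ∀ B : Set E, MeasurableSet B →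
      Pr⟦Y ⁻¹' B | m⟧ =ᵐ[Pr] fun ω => (κ (Z ω)).real B)
    {g : T × E → ENNReal} (hg : Measurable g) :
    ∫⁻ ω, g (Z ω, Y ω) ∂Pr = ∫⁻ ω, ∫⁻ x, g (Z ω, x) ∂(κ (Z ω)) ∂Pr := by
  have hZ' : Measurable Z := hZ.mono hm le_rfl
  have h := map_restrict_eq_compProd hm hZ hY hlaw MeasurableSet.univ
  rw [Measure.restrict_univ] at h
  rw [← lintegral_map (f := g) hg (hZ'.prodMk hY), h, Measure.lintegral_compProd hg,
    lintegral_map hg.lintegral_kernel_prod_right' hZ']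

/-- A function of the parameter and of the sample with conditional mean zero. -/
theorem condExp_sample_eq_zero (hm : m ≤ mΩ) {Z : Ω → T} {Y : Ω → E}
    (hZ : Measurable[m] Z) (hY : Measurable Y)
    (hlaw : ∀ B : Set E, MeasurableSet B →
      Pr⟦Y ⁻¹' B | m⟧ =ᵐ[Pr] fun ω => (κ (Z ω)).real B)
    {g : T × E → ℝ} (hg : Measurable g) (hint : Integrable (fun ω => g (Z ω, Y ω)) Pr)
    (h0 : ∀ t, ∫ x, g (t, x) ∂(κ t) = 0) :
    Pr[fun ω => g (Z ω, Y ω) | m] =ᵐ[Pr] 0 := by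
  have hZ' : Measurable Z := hZ.mono hm le_rfl
  refine (ae_eq_condExp_of_forall_setIntegral_eq hm hint (fun _ _ _ => integrableOn_zero) ?_
    aestronglyMeasurable_zero).symm
  intro U hU _
  have h := map_restrict_eq_compProd hm hZ hY hlaw hU
  have hi : Integrable g ((Pr.restrict U).map fun ω => (Z ω, Y ω)) :=
    (integrable_map_measure hg.aestronglyMeasurable (hZ'.prodMk hY).aemeasurable).2
      hint.integrableOn
  rw [← integral_map (f := g) (hZ'.prodMk hY).aemeasurable hg.aestronglyMeasurable, h,
    Measure.integral_compProd (h ▸ hi)]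
  simp [h0]

/-- Weighted sums of martingale differences with bounded second moments converge. -/
theorem ae_exists_tendsto_sum_sample (ℱ : Filtration ℕ mΩ) {Z : ℕ → Ω → T} {Y : ℕ → Ω → E}
    (hZ : ∀ n, Measurable[ℱ n] (Z n)) (hY : ∀ n, Measurable[ℱ (n + 1)] (Y (n + 1)))
    (hlaw : ∀ n, ∀ B : Set E, MeasurableSet B →
      Pr⟦Y (n + 1) ⁻¹' B | ℱ n⟧ =ᵐ[Pr] fun ω => (κ (Z n ω)).real B)
    {g : T × E → ℝ} (hg : Measurable g) (h0 : ∀ t, ∫ x, g (t, x) ∂(κ t) = 0) {C : ℝ}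
    (hC : ∀ t, ∫⁻ x, ENNReal.ofReal (g (t, x) ^ 2) ∂(κ t) ≤ ENNReal.ofReal C)
    {a : ℕ → ℝ} (ha : Summable fun n => a n ^ 2) :
    ∀ᵐ ω ∂Pr, ∃ c, Tendsto
      (fun n => ∑ k ∈ Finset.range n, a k * g (Z k ω, Y (k + 1) ω)) atTop (𝓝 c) := by
  have hZ' : ∀ n, Measurable (Z n) := fun n => (hZ n).mono (ℱ.le n) le_rfl
  have hY' : ∀ n, Measurable (Y (n + 1)) := fun n => (hY n).mono (ℱ.le _) le_rfl
  set D : ℕ → Ω → ℝ := fun k ω => g (Z k ω, Y (k + 1) ω) with hD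
  have hDm : ∀ k, StronglyMeasurable[ℱ (k + 1)] (D k) := fun k =>
    (hg.comp (((hZ k).mono (ℱ.mono k.le_succ) le_rfl).prodMk (hY k))).stronglyMeasurable
  have hDsq : ∀ k, ∫⁻ ω, ENNReal.ofReal (D k ω ^ 2) ∂Pr ≤ ENNReal.ofReal C := by
    intro k
    have h := lintegral_sample (ℱ.le k) (hZ k) (hY' k) (hlaw k)
      (g := fun z => ENNReal.ofReal (g z ^ 2)) (hg.pow_const 2).ennreal_ofReal
    rw [show ∫⁻ ω, ENNReal.ofReal (D k ω ^ 2) ∂Pr = _ from h]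
    exact (lintegral_mono fun ω => hC (Z k ω)).trans (by simp)
  have hD2i : ∀ k, Integrable (fun ω => D k ω ^ 2) Pr := by
    intro k
    refine ⟨(((hDm k).mono (ℱ.le _)).pow 2).aestronglyMeasurable, ?_⟩
    rw [hasFiniteIntegral_iff_ofReal (ae_of_all _ fun ω => sq_nonneg _)]
    exact (hDsq k).trans_lt ENNReal.ofReal_lt_top
  have hD2 : ∀ k, MemLp (D k) 2 Pr := fun k =>
    (memLp_two_iff_integrable_sq ((hDm k).mono (ℱ.le _)).aestronglyMeasurable).2 (hD2i k)
  have hC0 : ∀ k, ∫ ω, D k ω ^ 2 ∂Pr ≤ max C 0 := by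
    intro k
    rw [integral_eq_lintegral_of_nonneg_ae (ae_of_all _ fun ω => sq_nonneg _)
      (hD2i k).aestronglyMeasurable]
    refine (ENNReal.toReal_mono ENNReal.ofReal_ne_top (hDsq k)).trans ?_
    rw [ENNReal.toReal_ofReal']
  have hcond : ∀ k, Pr[D k | ℱ k] =ᵐ[Pr] 0 := fun k =>
    condExp_sample_eq_zero (ℱ.le k) (hZ k) (hY' k) (hlaw k) hg
      ((hD2 k).integrable (by norm_num)) h0
  set N : ℕ → Ω → ℝ := fun n ω => ∑ k ∈ Finset.range n, a k * D k ω with hN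
  have hNsucc : ∀ n ω, N (n + 1) ω = N n ω + a n * D n ω := fun n ω =>
    Finset.sum_range_succ _ _
  have hNm : ∀ n, StronglyMeasurable[ℱ n] (N n) := by
    intro n
    refine Finset.stronglyMeasurable_fun_sum _ fun k hk => ?_
    exact ((hDm k).mono (ℱ.mono (Finset.mem_range.1 hk))).const_mul (a k)
  have hN2 : ∀ n, MemLp (N n) 2 Pr := by
    intro n
    exact memLp_finsetSum _ fun k _ => (hD2 k).const_mul (a k)
  have hmart : Martingale N ℱ Pr := by
    refine martingale_of_condExp_sub_eq_zero_nat hNm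
      (fun n => (hN2 n).integrable (by norm_num)) fun n => ?_
    have h1 : N (n + 1) - N n = a n • D n := by
      ext ω; simp [hNsucc]
    rw [h1]
    refine (condExp_smul (a n) (D n) (ℱ n)).trans ?_
    filter_upwards [hcond n] with ω hω
    simp [hω]
  -- The partial sum `N n` is known at time `n` and the next increment has conditional mean zero, so
  -- the cross term drops out of the variance recursion.
  have horth : ∀ n, ∫ ω, N n ω * D n ω ∂Pr = 0 := by
    intro n
    have hi : Integrable (N n * D n) Pr := (hN2 n).integrable_mul (hD2 n)
    have h1 := condExp_mul_of_stronglyMeasurable_left (hNm n) hi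
      ((hD2 n).integrable (by norm_num))
    have h2 : Pr[N n * D n | ℱ n] =ᵐ[Pr] fun _ => (0 : ℝ) := by
      filter_upwards [h1, hcond n] with ω hω hω'
      simp [hω, hω']
    calc ∫ ω, N n ω * D n ω ∂Pr = ∫ ω, (Pr[N n * D n | ℱ n]) ω ∂Pr :=
          (integral_condExp (ℱ.le n)).symm
      _ = 0 := by rw [integral_congr_ae h2]; simp
  have hvar : ∀ n, ∫ ω, N n ω ^ 2 ∂Pr ≤ max C 0 * ∑ k ∈ Finset.range n, a k ^ 2 := by
    intro n
    induction n with
    | zero => simp [hN]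
    | succ n ih =>
      have e : ∀ ω, N (n + 1) ω ^ 2
          = (N n ω ^ 2 + 2 * a n * (N n ω * D n ω)) + a n ^ 2 * D n ω ^ 2 := by
        intro ω; rw [hNsucc]; ring
      have i1 : Integrable (fun ω => N n ω ^ 2) Pr := (hN2 n).integrable_sq
      have i2 : Integrable (fun ω => 2 * a n * (N n ω * D n ω)) Pr :=
        ((hN2 n).integrable_mul (hD2 n)).const_mul _
      have i3 : Integrable (fun ω => a n ^ 2 * D n ω ^ 2) Pr := (hD2i n).const_mul _
      have i12 : Integrable (fun ω => N n ω ^ 2 + 2 * a n * (N n ω * D n ω)) Pr := i1.add i2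
      simp_rw [e]
      rw [integral_add i12 i3, integral_add i1 i2, integral_const_mul,
        integral_const_mul, horth, Finset.sum_range_succ, mul_add]
      have := mul_le_mul_of_nonneg_left (hC0 n) (sq_nonneg (a n))
      linarith
  -- Martingale convergence needs an L¹ bound; it comes from the L² bound through `|t| ≤ 1 + t²`.
  set R : ℝ := 1 + max C 0 * ∑' k, a k ^ 2 with hR
  have hbound : ∀ n, eLpNorm (N n) 1 Pr ≤ (R.toNNReal : NNReal) := by
    intro n
    rw [eLpNorm_one_eq_lintegral_enorm]
    have h1 : ∫⁻ ω, ‖N n ω‖ₑ ∂Pr = ENNReal.ofReal (∫ ω, ‖N n ω‖ ∂Pr) := by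
      rw [ofReal_integral_norm_eq_lintegral_enorm ((hN2 n).integrable (by norm_num))]
    rw [h1]
    refine ENNReal.ofReal_le_ofReal ?_
    have h2 : ∫ ω, ‖N n ω‖ ∂Pr ≤ ∫ ω, (1 + N n ω ^ 2) ∂Pr := by
      refine integral_mono ((hN2 n).integrable (by norm_num)).norm
        ((integrable_const 1).add (hN2 n).integrable_sq) fun ω => ?_
      simp only [Real.norm_eq_abs]
      nlinarith [sq_abs (N n ω), sq_nonneg (|N n ω| - 1)]
    rw [integral_add (integrable_const 1) (hN2 n).integrable_sq] at h2
    have h3 := mul_le_mul_of_nonneg_left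
      (ha.sum_le_tsum (Finset.range n) fun k _ => sq_nonneg (a k)) (le_max_right C 0)
    have h4 := hvar n
    simp only [integral_const, probReal_univ, smul_eq_mul, mul_one] at h2
    linarith
  exact hmart.submartingale.exists_ae_tendsto_of_bdd hbound

/-- Summability of weighted squared norms with bounded means. -/
theorem ae_summable_sample (ℱ : Filtration ℕ mΩ) {Z : ℕ → Ω → T} {Y : ℕ → Ω → E}
    (hZ : ∀ n, Measurable[ℱ n] (Z n)) (hY : ∀ n, Measurable[ℱ (n + 1)] (Y (n + 1)))
    (hlaw : ∀ n, ∀ B : Set E, MeasurableSet B →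
      Pr⟦Y (n + 1) ⁻¹' B | ℱ n⟧ =ᵐ[Pr] fun ω => (κ (Z n ω)).real B)
    {g : T × E → ℝ} (hg : Measurable g) (hg0 : ∀ z, 0 ≤ g z) {C : ℝ}
    (hC : ∀ t, ∫⁻ x, ENNReal.ofReal (g (t, x)) ∂(κ t) ≤ ENNReal.ofReal C)
    {a : ℕ → ℝ} (ha : Summable a) (ha0 : ∀ n, 0 ≤ a n) :
    ∀ᵐ ω ∂Pr, Summable fun n => a n * g (Z n ω, Y (n + 1) ω) := by
  have hZ' : ∀ n, Measurable (Z n) := fun n => (hZ n).mono (ℱ.le n) le_rfl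
  have hY' : ∀ n, Measurable (Y (n + 1)) := fun n => (hY n).mono (ℱ.le _) le_rfl
  have hm : ∀ n, Measurable fun ω => ENNReal.ofReal (a n * g (Z n ω, Y (n + 1) ω)) := fun n =>
    ((hg.comp ((hZ' n).prodMk (hY' n))).const_mul (a n)).ennreal_ofReal
  -- By Tonelli the series of nonnegative terms has finite expectation, hence is finite almost
  -- surely.
  have hfin : ∫⁻ ω, ∑' n, ENNReal.ofReal (a n * g (Z n ω, Y (n + 1) ω)) ∂Pr ≠ ⊤ := by
    rw [lintegral_tsum fun n => (hm n).aemeasurable]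
    have hle : ∀ n, ∫⁻ ω, ENNReal.ofReal (a n * g (Z n ω, Y (n + 1) ω)) ∂Pr
        ≤ ENNReal.ofReal (a n) * ENNReal.ofReal C := by
      intro n
      simp_rw [ENNReal.ofReal_mul (ha0 n)]
      rw [lintegral_const_mul' _ _ ENNReal.ofReal_ne_top,
        lintegral_sample (ℱ.le n) (hZ n) (hY' n) (hlaw n)
        (g := fun z => ENNReal.ofReal (g z)) hg.ennreal_ofReal]
      gcongr
      exact (lintegral_mono fun ω => hC (Z n ω)).trans (by simp)
    refine ((ENNReal.tsum_le_tsum hle).trans_lt ?_).ne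
    rw [ENNReal.tsum_mul_right]
    exact ENNReal.mul_lt_top (lt_top_iff_ne_top.2 ha.tsum_ofReal_ne_top) ENNReal.ofReal_lt_top
  filter_upwards [ae_lt_top (Measurable.tsum hm) hfin] with ω hω
  refine (ENNReal.summable_toReal hω.ne).congr fun n => ?_
  rw [ENNReal.toReal_ofReal (mul_nonneg (ha0 n) (hg0 _))]

/-- Weighted sums of the centred samples, tested against bounded directions known in advance. -/
theorem ae_exists_tendsto_sum_inner_sample {d : ℕ} (ℱ : Filtration ℕ mΩ) {Z : ℕ → Ω → T}
    {Y : ℕ → Ω → E}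
    (hZ : ∀ n, Measurable[ℱ n] (Z n)) (hY : ∀ n, Measurable[ℱ (n + 1)] (Y (n + 1)))
    (hlaw : ∀ n, ∀ B : Set E, MeasurableSet B →
      Pr⟦Y (n + 1) ⁻¹' B | ℱ n⟧ =ᵐ[Pr] fun ω => (κ (Z n ω)).real B)
    {g : T × E → Vec d} (hg : Measurable g) {C : ℝ}
    (hgi : ∀ t, Integrable (fun x => ‖g (t, x)‖ ^ 2) (κ t))
    (hC : ∀ t, ∫ x, ‖g (t, x)‖ ^ 2 ∂(κ t) ≤ C)
    {w : T → Vec d} (hw : Measurable w) {D : ℝ} (hD : ∀ t, ‖w t‖ ≤ D)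
    {a : ℕ → ℝ} (ha : Summable fun n => a n ^ 2) :
    ∀ᵐ ω ∂Pr, ∃ c, Tendsto (fun n => ∑ k ∈ Finset.range n, a k * inner ℝ
      (g (Z k ω, Y (k + 1) ω) - ∫ x, g (Z k ω, x) ∂(κ (Z k ω))) (w (Z k ω))) atTop (𝓝 c) := by
  set h : T → Vec d := fun t => ∫ x, g (t, x) ∂(κ t) with hh
  have hhm : Measurable h := (hg.stronglyMeasurable.integral_kernel_prod_right').measurable
  have hgt : ∀ t, Measurable fun x => g (t, x) := fun t => hg.comp measurable_prodMk_left
  have hg1 : ∀ t, Integrable (fun x => g (t, x)) (κ t) := fun t =>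
    ((memLp_two_iff_integrable_sq_norm (hgt t).aestronglyMeasurable).2 (hgi t)).integrable
      (by norm_num)
  -- The constant comes from `r ≤ (1 + r²) / 2`; only boundedness of the mean matters.
  have hhle : ∀ t, ‖h t‖ ≤ (1 + C) / 2 := by
    intro t
    have h1 : ∫ x, ‖g (t, x)‖ ∂(κ t) ≤ ∫ x, (1 + ‖g (t, x)‖ ^ 2) / 2 ∂(κ t) :=
      integral_mono (hg1 t).norm (((integrable_const 1).add (hgi t)).div_const 2) fun x => by
        nlinarith [sq_nonneg (‖g (t, x)‖ - 1)]
    rw [integral_div, integral_add (integrable_const 1) (hgi t)] at h1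
    simp only [integral_const, probReal_univ, smul_eq_mul, mul_one] at h1
    have h2 := norm_integral_le_integral_norm (μ := κ t) fun x => g (t, x)
    have h3 := hC t
    change ‖∫ x, g (t, x) ∂(κ t)‖ ≤ _
    linarith
  refine ae_exists_tendsto_sum_sample (κ := κ) ℱ hZ hY hlaw
    (g := fun z => inner ℝ (g z - h z.1) (w z.1))
    ((hg.sub (hhm.comp measurable_fst)).inner (hw.comp measurable_fst)) (fun t => ?_)
    (C := 2 * D ^ 2 * (C + ((1 + C) / 2) ^ 2)) (fun t => ?_) ha
  · have hi : Integrable (fun x => g (t, x) - h t) (κ t) := (hg1 t).sub (integrable_const _)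
    simp_rw [real_inner_comm (w t)]
    rw [integral_inner hi, integral_sub (hg1 t) (integrable_const _)]
    simp [hh]
  -- Cauchy–Schwarz followed by `(r + s)² ≤ 2 r² + 2 s²` gives the variance constant.
  · have hb : ∀ x, inner ℝ (g (t, x) - h t) (w t) ^ 2
        ≤ 2 * D ^ 2 * (‖g (t, x)‖ ^ 2 + ((1 + C) / 2) ^ 2) := by
      intro x
      have h1 : |inner ℝ (g (t, x) - h t) (w t)| ≤ (‖g (t, x)‖ + (1 + C) / 2) * D := by
        refine (abs_real_inner_le_norm _ _).trans ?_
        have := hD t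
        have := hhle t
        have := (norm_nonneg _).trans (hhle t)
        gcongr
        exact (norm_sub_le _ _).trans (by gcongr)
      have h2 : inner ℝ (g (t, x) - h t) (w t) ^ 2 ≤ ((‖g (t, x)‖ + (1 + C) / 2) * D) ^ 2 := by
        rw [← sq_abs]; gcongr
      refine h2.trans ?_
      have : 0 ≤ D ^ 2 * (‖g (t, x)‖ - (1 + C) / 2) ^ 2 := by positivity
      nlinarith
    have hi : Integrable (fun x => 2 * D ^ 2 * (‖g (t, x)‖ ^ 2 + ((1 + C) / 2) ^ 2)) (κ t) :=
      ((hgi t).add (integrable_const _)).const_mul _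
    refine (lintegral_mono fun x => ENNReal.ofReal_le_ofReal (hb x)).trans ?_
    rw [← ofReal_integral_eq_lintegral_ofReal hi
      (ae_of_all _ fun x => (sq_nonneg _).trans (hb x))]
    refine ENNReal.ofReal_le_ofReal ?_
    rw [integral_const_mul, integral_add (hgi t) (integrable_const _)]
    simp only [integral_const, probReal_univ, smul_eq_mul, one_mul]
    have := hC t
    gcongr

end Sampling

/-! ### Normal cones of polyhedra -/

section Polyhedron

variable {k n : ℕ} {A : Matrix (Fin k) (Fin n) ℝ} {b : Fin k → ℝ}

theorem continuous_mulVec_apply (i : Fin k) : Continuous fun x : Vec n => (A *ᵥ x.ofLp) i := by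
  simp only [Matrix.mulVec, dotProduct]
  fun_prop

/-- Inactive constraints are strict inequalities and hence stable under small perturbations. This
polyhedral fact makes the Fenchel coupling equal to the squared distance near `p`. -/
theorem eventually_activeSet_subset {p : Vec n} (hp : p ∈ polyhedron A b) :
    ∀ᶠ x in 𝓝 p, activeSet A b x ⊆ activeSet A b p := by
  have h : ∀ᶠ x in 𝓝 p, ∀ i, i ∉ activeSet A b p → i ∉ activeSet A b x := by
    refine eventually_all.2 fun i => ?_
    by_cases hi : i ∈ activeSet A b p
    · exact Eventually.of_forall fun x h => absurd hi h
    · have hlt : (A *ᵥ p.ofLp) i < b i := lt_of_le_of_ne (hp i) hi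
      filter_upwards [(continuous_mulVec_apply i).continuousAt.eventually_lt
        continuousAt_const hlt] with x hx _
      exact hx.ne
  filter_upwards [h] with x hx i hi
  by_contra hc
  exact hx i hc hi

theorem sub_mem_activeKer {x u w : Vec n} (hu : activeSet A b x ⊆ activeSet A b u)
    (hw : activeSet A b x ⊆ activeSet A b w) : u - w ∈ activeKer A b x := by
  intro i hi
  have h1 : (A *ᵥ u.ofLp) i = b i := hu hi
  have h2 : (A *ᵥ w.ofLp) i = b i := hw hi
  simp [Matrix.mulVec_sub, h1, h2]

/-- A short move along `u` keeps the active constraints tight and the others strict, so it stays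
feasible and can be tested against the normal vector. -/
theorem inner_nonpos_of_mem_activeKer {x z u : Vec n} (hx : x ∈ polyhedron A b)
    (hz : ∀ w ∈ polyhedron A b, inner ℝ z (w - x) ≤ 0) (hu : u ∈ activeKer A b x) :
    inner ℝ z u ≤ 0 := by
  have hev : ∀ᶠ t : ℝ in 𝓝[>] 0, ∀ i, (A *ᵥ (x + t • u).ofLp) i ≤ b i := by
    refine eventually_all.2 fun i => ?_
    by_cases hi : i ∈ activeSet A b x
    · have h1 : (A *ᵥ x.ofLp) i = b i := hi
      refine Eventually.of_forall fun t => ?_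
      simp [Matrix.mulVec_add, Matrix.mulVec_smul, hu i hi, h1]
    · have hlt : (A *ᵥ x.ofLp) i < b i := lt_of_le_of_ne (hx i) hi
      have hc : Continuous fun t : ℝ => (A *ᵥ (x + t • u).ofLp) i :=
        (continuous_mulVec_apply i).comp (by fun_prop)
      have := hc.continuousAt (x := 0).eventually_lt (continuousAt_const (y := b i))
        (by simpa using hlt)
      filter_upwards [this.filter_mono nhdsWithin_le_nhds] with t ht
      exact ht.le
  obtain ⟨t, ht, ht0⟩ := (hev.and self_mem_nhdsWithin).exists
  have ht0 : 0 < t := ht0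
  have h := hz _ ht
  rw [add_sub_cancel_left, inner_smul_right] at h
  exact nonpos_of_mul_nonpos_right h ht0

/-- Normal vectors at `x` are orthogonal to the null space of the active constraints. -/
theorem inner_eq_zero_of_mem_activeKer {x z u : Vec n} (hx : x ∈ polyhedron A b)
    (hz : ∀ w ∈ polyhedron A b, inner ℝ z (w - x) ≤ 0) (hu : u ∈ activeKer A b x) :
    inner ℝ z u = 0 := by
  refine le_antisymm (inner_nonpos_of_mem_activeKer hx hz hu) ?_
  have := inner_nonpos_of_mem_activeKer hx hz (neg_mem hu)
  rw [inner_neg_right] at this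
  linarith

end Polyhedron

/-! ### Projections -/

/-- Used to see that the iterates are measurable functions of their dual variables, which makes them
adapted. -/
theorem exists_projection {n : ℕ} {K : Set (Vec n)} (hne : K.Nonempty) (hcl : IsClosed K)
    (hconv : Convex ℝ K) :
    ∃ π : Vec n → Vec n, Measurable π ∧
      ∀ y, ∀ x ∈ K, (∀ w ∈ K, inner ℝ (y - x) (w - x) ≤ 0) → x = π y := by
  have h : ∀ y, ∃ x ∈ K, ∀ w ∈ K, inner ℝ (y - x) (w - x) ≤ 0 := by
    intro y
    obtain ⟨x, hx, hxy⟩ := exists_norm_eq_iInf_of_complete_convex hne hcl.isComplete hconv y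
    exact ⟨x, hx, (norm_eq_iInf_iff_real_inner_le_zero hconv hx).1 hxy⟩
  choose π hπ hVI using h
  -- Nonexpansiveness, with `x` any solution of the variational inequality for `y`: taking `x = π y`
  -- gives the Lipschitz bound, and taking `y' = y` gives uniqueness.
  have key : ∀ y y' x, x ∈ K → (∀ w ∈ K, inner ℝ (y - x) (w - x) ≤ 0) →
      ‖x - π y'‖ ≤ ‖y - y'‖ := by
    intro y y' x hx h
    have h1 := h _ (hπ y')
    have h2 := hVI y' x hx
    have h3 : ‖x - π y'‖ ^ 2 ≤ inner ℝ (y - y') (x - π y') := by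
      rw [← real_inner_self_eq_norm_sq]
      have e : inner ℝ (y - y') (x - π y') - inner ℝ (x - π y') (x - π y')
          = -(inner ℝ (y - x) (π y' - x)) - inner ℝ (y' - π y') (x - π y') := by
        rw [← neg_sub x (π y'), inner_neg_right, neg_neg, ← inner_sub_left, ← inner_sub_left]
        congr 1
        abel
      linarith
    have h4 := real_inner_le_norm (y - y') (x - π y')
    by_contra! hlt
    nlinarith [norm_nonneg (y - y')]
  refine ⟨π, (LipschitzWith.of_dist_le_mul (K := 1) fun y y' => ?_).continuous.measurable, ?_⟩
  · rw [dist_eq_norm, dist_eq_norm]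
    simpa using key y y' (π y) (hπ y) (hVI y)
  · intro y x hx h
    have := key y y x hx h
    rw [sub_self, norm_zero] at this
    exact sub_eq_zero.1 (norm_le_zero_iff.1 this)

/-- The minimizer of a linear function plus half the squared distance to `x₀`. -/
theorem inner_le_zero_of_isMinOn {n : ℕ} {K : Set (Vec n)} (hconv : Convex ℝ K)
    {g x₀ x : Vec n} (hx : x ∈ K)
    (hmin : ∀ w ∈ K, inner ℝ g x + ‖x - x₀‖ ^ 2 / 2 ≤ inner ℝ g w + ‖w - x₀‖ ^ 2 / 2) :
    ∀ w ∈ K, inner ℝ (x₀ - g - x) (w - x) ≤ 0 := by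
  -- Completing the square: the minimizer is the projection of `x₀ - g`.
  have e : ∀ w, ‖x₀ - g - w‖ ^ 2
      = 2 * (inner ℝ g w + ‖w - x₀‖ ^ 2 / 2) + ‖g‖ ^ 2 - 2 * inner ℝ g x₀ := by
    intro w
    have : x₀ - g - w = -((w - x₀) + g) := by abel
    rw [this, norm_neg, norm_add_sq_real, inner_sub_left, real_inner_comm g w,
      real_inner_comm g x₀]
    ring
  have : Nonempty K := ⟨⟨x, hx⟩⟩
  refine (norm_eq_iInf_iff_real_inner_le_zero hconv hx).1 (le_antisymm ?_ ?_)
  · refine le_ciInf fun w => ?_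
    refine (sq_le_sq₀ (norm_nonneg _) (norm_nonneg _)).1 ?_
    rw [e, e]
    have := hmin w w.2
    linarith
  · exact ciInf_le ⟨0, by rintro _ ⟨w, rfl⟩; exact norm_nonneg _⟩ (⟨x, hx⟩ : K)

/-! ### Dual averaging along a path -/

section Path

/-- Descent of the Fenchel coupling. -/
theorem coupling_descent {n : ℕ} {x x' y y' p : Vec n} (h : inner ℝ (y - x) (x' - x) ≤ 0) :
    ‖p - y'‖ ^ 2 - ‖x' - y'‖ ^ 2
      ≤ ‖p - y‖ ^ 2 - ‖x - y‖ ^ 2 + 2 * inner ℝ (x - p) (y' - y) + ‖y' - y‖ ^ 2 := by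
  -- The right side minus the left side is exactly this square plus `2⟪x - y, x' - x⟫`, which is
  -- nonnegative by `h`.
  have h0 : 0 ≤ ‖(x' - x) - (y' - y)‖ ^ 2 := by positivity
  have e1 : p - y' = (p - x) + (x - y) - (y' - y) := by abel
  have e2 : x' - y' = (x' - x) + (x - y) - (y' - y) := by abel
  have e3 : p - y = (p - x) + (x - y) := by abel
  rw [e1, e2, e3]
  rw [← neg_sub x y, inner_neg_left] at h
  rw [← neg_sub p x, inner_neg_left]
  generalize x' - x = d at *
  generalize x - y = c at *
  generalize p - x = f at *
  generalize y' - y = o at *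
  simp only [norm_sub_sq_real, norm_add_sq_real, inner_add_left] at *
  rw [real_inner_comm c d]
  linarith

/-- Expanding around `x`, the difference of the two sides is `-2⟪y - x, p - x⟫`, nonnegative when
`x` is the projection of `y`. -/
theorem sq_norm_le_coupling {n : ℕ} {x y p : Vec n} (h : inner ℝ (y - x) (p - x) ≤ 0) :
    ‖x - p‖ ^ 2 ≤ ‖p - y‖ ^ 2 - ‖x - y‖ ^ 2 := by
  have e3 : p - y = (p - x) - (y - x) := by abel
  rw [e3, norm_sub_sq_real (p - x), norm_sub_rev x p, norm_sub_rev x y, real_inner_comm]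
  linarith

/-- When the residual `y - x` is orthogonal to `p - x`, the cross term vanishes. The coupling then
forgets the possibly unbounded dual variable. -/
theorem coupling_eq {n : ℕ} {x y p : Vec n} (h : inner ℝ (y - x) (p - x) = 0) :
    ‖p - y‖ ^ 2 - ‖x - y‖ ^ 2 = ‖x - p‖ ^ 2 := by
  have e3 : p - y = (p - x) - (y - x) := by abel
  rw [e3, norm_sub_sq_real (p - x), norm_sub_rev x p, norm_sub_rev x y, real_inner_comm, h]
  ring

variable {k n : ℕ} {A : Matrix (Fin k) (Fin n) ℝ} {b : Fin k → ℝ} {p : Vec n}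
  {x y g h : ℕ → Vec n} {a : ℕ → ℝ}

/-- Convergence of dual averaging on a polyhedron, along a path on which the weighted noise is
summable. -/
theorem dualAveraging_tendsto (hp : p ∈ polyhedron A b) (hx : ∀ j, x j ∈ polyhedron A b)
    (hVI : ∀ j, ∀ w ∈ polyhedron A b, inner ℝ (y j - x j) (w - x j) ≤ 0)
    (hy : ∀ j, y (j + 1) = y j - a j • g j) (ha0 : ∀ j, 0 ≤ a j) (ha : ¬ Summable a)
    {c : ℝ} (hc : 0 < c) {e : ℕ → ℝ} (he : Summable e)
    (hgrowth : ∀ j, c * (a j * ‖x j - p‖ ^ 2) - e j ≤ a j * inner ℝ (h j) (x j - p))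
    (hnoise : ∃ l, Tendsto (fun N => ∑ j ∈ Finset.range N, a j * inner ℝ (g j - h j) (x j - p))
      atTop (𝓝 l))
    (hsq : Summable fun j => a j ^ 2 * ‖g j‖ ^ 2) :
    (Summable fun j => a j * ‖x j - p‖ ^ 2) ∧ Tendsto x atTop (𝓝 p) := by
  set F : ℕ → ℝ := fun j => ‖p - y j‖ ^ 2 - ‖x j - y j‖ ^ 2 with hF
  have hFle : ∀ j, ‖x j - p‖ ^ 2 ≤ F j := fun j => sq_norm_le_coupling (hVI j p hp)
  -- All perturbations of the descent inequality; the partial sums `W` converge, although the noise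
  -- part need not converge absolutely.
  set t : ℕ → ℝ := fun j => 2 * e j + a j ^ 2 * ‖g j‖ ^ 2
    - 2 * (a j * inner ℝ (g j - h j) (x j - p)) with ht
  have hdesc : ∀ j, F (j + 1) ≤ F j + t j - 2 * c * (a j * ‖x j - p‖ ^ 2) := by
    intro j
    have h1 := coupling_descent (p := p) (y' := y (j + 1)) (hVI j (x (j + 1)) (hx _))
    have h2 : y (j + 1) - y j = -(a j • g j) := by rw [hy]; abel
    rw [h2, norm_neg, norm_smul, inner_neg_right, inner_smul_right, mul_pow, Real.norm_eq_abs,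
      sq_abs, real_inner_comm] at h1
    have h3 := hgrowth j
    have h4 : inner ℝ (g j) (x j - p)
        = inner ℝ (g j - h j) (x j - p) + inner ℝ (h j) (x j - p) := by
      rw [← inner_add_left, sub_add_cancel]
    rw [h4] at h1
    simp only [ht, hF]
    linarith
  obtain ⟨l, hl⟩ := hnoise
  set W : ℕ → ℝ := fun N => ∑ j ∈ Finset.range N, t j with hW
  have hWlim : ∃ L, Tendsto W atTop (𝓝 L) := by
    refine ⟨2 * (∑' j, e j) + (∑' j, a j ^ 2 * ‖g j‖ ^ 2) - 2 * l, ?_⟩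
    have := ((he.hasSum.tendsto_sum_nat.const_mul 2).add hsq.hasSum.tendsto_sum_nat).sub
      (hl.const_mul 2)
    refine this.congr fun N => ?_
    simp only [hW, ht, Finset.sum_sub_distrib, Finset.sum_add_distrib, Finset.mul_sum]
  obtain ⟨L, hL⟩ := hWlim
  obtain ⟨B, hB⟩ := hL.bddAbove_range
  have hB : ∀ N, W N ≤ B := fun N => hB ⟨N, rfl⟩
  have hq0 : ∀ j, 0 ≤ a j * ‖x j - p‖ ^ 2 := fun j => mul_nonneg (ha0 j) (sq_nonneg _)
  have hV : ∀ N, F (N + 1) - W (N + 1) ≤ F N - W N - 2 * c * (a N * ‖x N - p‖ ^ 2) := by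
    intro N
    have := hdesc N
    simp only [hW, Finset.sum_range_succ]
    linarith
  have hsum : Summable fun j => a j * ‖x j - p‖ ^ 2 := by
    have hpart : ∀ N, 2 * c * ∑ j ∈ Finset.range N, a j * ‖x j - p‖ ^ 2
        ≤ F 0 - (F N - W N) := by
      intro N
      induction N with
      | zero => simp [hW]
      | succ N ih =>
        rw [Finset.sum_range_succ, mul_add]
        linarith [hV N]
    refine summable_of_sum_range_le (c := (F 0 + B) / (2 * c)) hq0 fun N => ?_
    rw [le_div_iff₀ (by positivity)]
    linarith [hpart N, hB N, (sq_nonneg _).trans (hFle N)]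
  refine ⟨hsum, ?_⟩
  -- After removal of the accumulated perturbations the coupling is monotone and bounded below, so
  -- `F` itself converges.
  have hanti : Antitone fun N => F N - W N := antitone_nat_of_succ_le fun N => by
    have := hV N
    have := mul_nonneg hc.le (hq0 N)
    linarith
  have hFlim : ∃ F₀, Tendsto F atTop (𝓝 F₀) := by
    have hbdd : BddBelow (Set.range fun N => F N - W N) :=
      ⟨-B, by rintro _ ⟨N, rfl⟩; linarith [hB N, (sq_nonneg _).trans (hFle N)]⟩
    exact ⟨_, ((tendsto_atTop_ciInf hanti hbdd).add hL).congr fun N => by ring⟩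
  obtain ⟨F₀, hF₀⟩ := hFlim
  -- Otherwise `a j ≤ δ⁻¹ * (a j * ‖x j - p‖ ^ 2)` eventually, and the steps would be summable.
  have hfreq : ∀ δ > 0, ∃ᶠ j in atTop, ‖x j - p‖ ^ 2 < δ := by
    intro δ hδ hcon
    refine ha ((hsum.mul_left δ⁻¹).of_norm_bounded_eventually_nat ?_)
    filter_upwards [hcon] with j hj
    rw [Real.norm_of_nonneg (ha0 j), inv_mul_eq_div, le_div_iff₀ hδ]
    exact mul_le_mul_of_nonneg_left (not_lt.1 hj) (ha0 j)
  obtain ⟨ε, hε, hball⟩ := Metric.eventually_nhds_iff.1 (eventually_activeSet_subset hp)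
  have hFeq : ∀ j, ‖x j - p‖ ^ 2 < ε ^ 2 → F j = ‖x j - p‖ ^ 2 := by
    intro j hj
    have hd : dist (x j) p < ε := by
      rw [dist_eq_norm]; exact lt_of_pow_lt_pow_left₀ 2 hε.le hj
    exact coupling_eq (inner_eq_zero_of_mem_activeKer (hx j) (hVI j)
      (sub_mem_activeKer (hball hd) subset_rfl))
  -- At the recurrent visits near `p` the coupling is the squared distance, hence arbitrarily small.
  have hF₀0 : F₀ ≤ 0 := by
    by_contra! hpos
    have hev := hF₀.eventually (lt_mem_nhds (half_lt_self hpos))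
    obtain ⟨j, hj, hj'⟩ := ((hfreq (min (ε ^ 2) (F₀ / 2)) (by positivity)).and_eventually
      hev).exists
    rw [hFeq j (hj.trans_le (min_le_left _ _))] at hj'
    exact (hj'.trans (hj.trans_le (min_le_right _ _))).false
  have hF₀' : F₀ = 0 := le_antisymm hF₀0
    (ge_of_tendsto' hF₀ fun j => (sq_nonneg _).trans (hFle j))
  have hsq0 : Tendsto (fun j => ‖x j - p‖ ^ 2) atTop (𝓝 0) :=
    squeeze_zero (fun j => sq_nonneg _) hFle (hF₀' ▸ hF₀)
  rw [tendsto_iff_norm_sub_tendsto_zero]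
  have := hsq0.sqrt
  simpa using this

/-- The inner product is the sum of the multipliers times the slacks at `q` of the constraints
active at `p`; some slack is positive and its multiplier is strictly positive. -/
theorem inner_pos_of_multipliers {p q hstar : Vec n} (hq : q ∈ polyhedron A b) {lam : Fin k → ℝ}
    (hlam : ∀ i ∈ activeSet A b p, 0 < lam i) (hlam0 : ∀ i ∉ activeSet A b p, lam i = 0)
    (heq : (-hstar).ofLp = Aᵀ *ᵥ lam) (hqp : ¬ activeSet A b p ⊆ activeSet A b q) :
    0 < inner ℝ (-hstar) (p - q) := by
  have h1 : inner ℝ (-hstar) (p - q) = ∑ i, lam i * ((A *ᵥ p.ofLp) i - (A *ᵥ q.ofLp) i) := by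
    rw [real_inner_comm, EuclideanSpace.inner_eq_star_dotProduct, heq]
    simp only [star_trivial]
    rw [Matrix.mulVec_transpose, ← Matrix.dotProduct_mulVec, dotProduct]
    simp [Matrix.mulVec_sub]
  rw [h1]
  obtain ⟨i, hip, hiq⟩ := Set.not_subset.1 hqp
  refine Finset.sum_pos' (fun j _ => ?_) ⟨i, Finset.mem_univ i, ?_⟩
  · by_cases hj : j ∈ activeSet A b p
    · have hjp : (A *ᵥ p.ofLp) j = b j := hj
      rw [hjp]
      exact mul_nonneg (hlam j hj).le (sub_nonneg.2 (hq j))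
    · simp [hlam0 j hj]
  · have hip' : (A *ᵥ p.ofLp) i = b i := hip
    rw [hip']
    exact mul_pos (hlam i hip) (sub_pos.2 (lt_of_le_of_ne (hq i) hiq))

/-- Finite identification of the active constraints by dual averaging. -/
theorem dualAveraging_activeSet (hx : ∀ j, x j ∈ polyhedron A b)
    (hVI : ∀ j, ∀ w ∈ polyhedron A b, inner ℝ (y j - x j) (w - x j) ≤ 0)
    (hy : ∀ j, y (j + 1) = y j - a j • g j) (ha0 : ∀ j, 0 ≤ a j) (ha : ¬ Summable a)
    (hlim : Tendsto x atTop (𝓝 p)) {hstar : Vec n} (hhlim : Tendsto h atTop (𝓝 hstar))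
    (hnoise : ∀ i, ∃ l, Tendsto (fun N => ∑ j ∈ Finset.range N, a j *
      inner ℝ (g j - h j) (EuclideanSpace.single i (1 : ℝ))) atTop (𝓝 l))
    {lam : Fin k → ℝ} (hlam : ∀ i ∈ activeSet A b p, 0 < lam i)
    (hlam0 : ∀ i ∉ activeSet A b p, lam i = 0) (heq : (-hstar).ofLp = Aᵀ *ᵥ lam) :
    ∀ᶠ j in atTop, activeSet A b (x j) = activeSet A b p := by
  have hp : p ∈ polyhedron A b := isClosed_polyhedron.mem_of_tendsto hlim (.of_forall hx)
  have hsub : ∀ᶠ j in atTop, activeSet A b (x j) ⊆ activeSet A b p :=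
    hlim.eventually (eventually_activeSet_subset hp)
  by_contra hcon
  have hfr : ∃ᶠ j in atTop, ∃ I : Set (Fin k), I ≠ activeSet A b p ∧ activeSet A b (x j) = I :=
    (not_eventually.1 hcon).mono fun j hj => ⟨_, hj, rfl⟩
  -- There are finitely many active sets, so a single wrong set `I` recurs infinitely often.
  rw [frequently_exists] at hfr
  obtain ⟨I, hI⟩ := hfr
  obtain ⟨j₀, ⟨hIne, hj₀⟩, hj₀sub⟩ := (hI.and_eventually hsub).exists
  rw [hj₀] at hj₀sub
  set u : Vec n := p - x j₀ with hu
  have hpos : 0 < inner ℝ (-hstar) u := by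
    refine inner_pos_of_multipliers (hx j₀) hlam hlam0 heq fun hs => hIne ?_
    rw [hj₀] at hs
    exact hj₀sub.antisymm hs
  -- One fixed `u` works for every visit to `I`: the constraints in `I` are active both at `p` and
  -- at `x j₀`, so `u` is in the null space for `I`.
  have horth : ∃ᶠ j in atTop, inner ℝ (y j - x j) u = 0 := by
    refine hI.mono fun j hj => inner_eq_zero_of_mem_activeKer (hx j) (hVI j) ?_
    refine sub_mem_activeKer ?_ ?_
    · rw [hj.2]; exact hj₀sub
    · rw [hj.2, hj₀]
  set σ : ℕ → ℝ := fun N => ∑ j ∈ Finset.range N, a j with hσ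
  have hσlim : Tendsto σ atTop atTop := (not_summable_iff_tendsto_nat_atTop_of_nonneg ha0).1 ha
  have hnoise' : ∃ l, Tendsto (fun N => ∑ j ∈ Finset.range N, a j * inner ℝ (g j - h j) u)
      atTop (𝓝 l) := by
    choose l hl using hnoise
    refine ⟨∑ i, u.ofLp i * l i, (tendsto_finsetSum Finset.univ fun i _ =>
      (hl i).const_mul (u.ofLp i)).congr fun N => ?_⟩
    simp_rw [Finset.mul_sum]
    rw [Finset.sum_comm]
    refine Finset.sum_congr rfl fun j _ => ?_
    simp only [PiLp.inner_apply, Finset.mul_sum]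
    refine Finset.sum_congr rfl fun i _ => ?_
    simp
    ring
  obtain ⟨l, hl⟩ := hnoise'
  have hyu : ∀ N, inner ℝ (y N - x N) u + σ N * inner ℝ hstar u = inner ℝ (y 0 - x N) u
      - (∑ j ∈ Finset.range N, a j * inner ℝ (g j - h j) u)
      - ∑ j ∈ Finset.range N, a j * inner ℝ (h j - hstar) u := by
    have hyN : ∀ N, inner ℝ (y N) u = inner ℝ (y 0) u
        - ∑ j ∈ Finset.range N, a j * inner ℝ (g j) u := by
      intro N
      induction N with
      | zero => simp
      | succ N ih =>
        rw [hy, inner_sub_left, ih, inner_smul_left, Finset.sum_range_succ]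
        simp only [conj_trivial]
        ring
    intro N
    rw [inner_sub_left, hyN N]
    simp only [inner_sub_left, hσ, mul_sub, Finset.sum_sub_distrib, Finset.sum_mul]
    ring
  -- The drift is `-σ N * inner ℝ hstar u`. The remainder consists of a bounded term, convergent
  -- noise and a weighted Cesàro sum of terms tending to zero, all negligible against `σ`.
  have hlittle : (fun N => inner ℝ (y N - x N) u + σ N * inner ℝ hstar u) =o[atTop] σ := by
    have o1 : (fun N => inner ℝ (y 0 - x N) u) =o[atTop] σ := by
      have h1 : Tendsto (fun N => inner ℝ (y 0 - x N) u) atTop (𝓝 (inner ℝ (y 0 - p) u)) :=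
        (tendsto_const_nhds.sub hlim).inner tendsto_const_nhds
      exact (h1.isBigO_one ℝ).trans_isLittleO
        ((Asymptotics.isLittleO_const_left_of_ne one_ne_zero).2
          (tendsto_norm_atTop_atTop.comp hσlim))
    have o2 : (fun N => ∑ j ∈ Finset.range N, a j * inner ℝ (g j - h j) u) =o[atTop] σ :=
      (hl.isBigO_one ℝ).trans_isLittleO
        ((Asymptotics.isLittleO_const_left_of_ne one_ne_zero).2
          (tendsto_norm_atTop_atTop.comp hσlim))
    have o3 : (fun N => ∑ j ∈ Finset.range N, a j * inner ℝ (h j - hstar) u) =o[atTop] σ := by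
      refine Asymptotics.IsLittleO.sum_range ?_ ha0 hσlim
      have h1 : Tendsto (fun j => inner ℝ (h j - hstar) u) atTop (𝓝 0) := by
        have := Tendsto.inner (𝕜 := ℝ) (hhlim.sub_const hstar) (tendsto_const_nhds (x := u))
        simpa using this
      have h2 := (Asymptotics.isBigO_refl a atTop).mul_isLittleO
        ((Asymptotics.isLittleO_one_iff ℝ).2 h1)
      simpa using h2
    exact ((o1.sub o2).sub o3).congr_left fun N => (hyu N).symm
  have hneg : inner ℝ hstar u < 0 := by
    rw [inner_neg_left] at hpos
    linarith
  -- At a visit to `I` the residual term vanishes, leaving the whole drift bounded by half of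
  -- itself.
  have hbd := hlittle.def (half_pos hpos)
  obtain ⟨N, hN, hNb, hNσ⟩ :=
    (horth.and_eventually (hbd.and (hσlim.eventually_gt_atTop 0))).exists
  rw [hN, zero_add, norm_mul, Real.norm_of_nonneg hNσ.le, inner_neg_left, Real.norm_eq_abs,
    abs_of_neg hneg] at hNb
  nlinarith

end Path

/-! ### Convexity -/

/-- First order lower bound for a convex function, with the gradient of its restriction. -/
theorem convexOn_gradientWithin_le {n : ℕ} {K : Set (Vec n)} {g : Vec n → ℝ}
    (h : ConvexOn ℝ K g) {x y g' : Vec n} (hx : x ∈ K) (hy : y ∈ K)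
    (hg : HasGradientWithinAt g g' K x) : inner ℝ g' (y - x) ≤ g y - g x := by
  have hmem : ∀ t ∈ Set.Icc (0 : ℝ) 1, x + t • (y - x) ∈ K := fun t ht => by
    have := h.1 hx hy (sub_nonneg.2 ht.2) ht.1 (by ring)
    rwa [show (1 - t) • x + t • y = x + t • (y - x) by module] at this
  have hline : HasDerivWithinAt (fun t : ℝ => g (x + t • (y - x))) (inner ℝ g' (y - x))
      (Set.Icc 0 1) 0 := by
    have h1 : HasDerivWithinAt (fun t : ℝ => x + t • (y - x)) (y - x) (Set.Icc 0 1) 0 := by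
      simpa using (((hasDerivAt_id (0 : ℝ)).smul_const (y - x)).const_add x).hasDerivWithinAt
    have h2 : HasFDerivWithinAt g (InnerProductSpace.toDual ℝ (Vec n) g') K
        (x + (0 : ℝ) • (y - x)) := by
      simpa using hg.hasFDerivWithinAt
    have h3 := h2.comp_hasDerivWithinAt (0 : ℝ) h1 hmem
    rw [InnerProductSpace.toDual_apply_apply] at h3
    exact h3
  have hslope := hasDerivWithinAt_iff_tendsto_slope.1 hline
  have hle : 𝓝[>] (0 : ℝ) ≤ 𝓝[Set.Icc (0 : ℝ) 1 \ {0}] 0 := by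
    rw [← nhdsWithin_Ioo_eq_nhdsGT (zero_lt_one (α := ℝ))]
    exact nhdsWithin_mono _ fun t ht => ⟨Set.Ioo_subset_Icc_self ht, ht.1.ne'⟩
  refine le_of_tendsto (hslope.mono_left hle) ?_
  filter_upwards [Ioo_mem_nhdsGT (zero_lt_one (α := ℝ))] with t ht
  have hc := h.2 hx hy (sub_nonneg.2 ht.2.le) ht.1.le (by ring)
  have he : x + t • (y - x) = (1 - t) • x + t • y := by module
  rw [slope_def_field, he, div_le_iff₀ (by linarith [ht.1])]
  simp only [smul_eq_mul, zero_smul, add_zero, sub_zero] at hc ⊢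
  linarith

/-! ### Measurability of the projectors -/

theorem activeProj_congr {k n : ℕ} {A : Matrix (Fin k) (Fin n) ℝ} {b : Fin k → ℝ} {x y : Vec n}
    (h : activeSet A b x = activeSet A b y) : activeProj A b x = activeProj A b y := by
  have : activeKer A b x = activeKer A b y := by
    ext u
    change (∀ i ∈ activeSet A b x, _) ↔ (∀ i ∈ activeSet A b y, _)
    rw [h]
  simp only [activeProj, this]

theorem measurable_activeSet {k n : ℕ} (A : Matrix (Fin k) (Fin n) ℝ) (b : Fin k → ℝ) :
    Measurable (activeSet A b) :=
  measurable_set_iff.2 fun i => measurableSet_setOfPred.1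
    (measurableSet_eq_fun (continuous_mulVec_apply i).measurable measurable_const)

/-- The projector is not continuous in the base point but depends on it only through its active set,
which takes finitely many values. -/
theorem measurable_activeProj {k n : ℕ} (A : Matrix (Fin k) (Fin n) ℝ) (b : Fin k → ℝ) :
    Measurable fun z : Vec n × Vec n => activeProj A b z.1 z.2 := by
  classical
  let Φ : Set (Fin k) × Vec n → Vec n := fun z =>
    if h : ∃ x, activeSet A b x = z.1 then activeProj A b h.choose z.2 else 0
  have hΦ : Measurable Φ := by
    refine measurable_from_prod_countable_right fun I => ?_
    by_cases h : ∃ x, activeSet A b x = I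
    · simp only [Φ, h, dite_true]
      exact (activeProj A b h.choose).continuous.measurable
    · simp only [Φ, h, dite_false]
      exact measurable_const
  have heq : (fun z : Vec n × Vec n => activeProj A b z.1 z.2)
      = fun z => Φ (activeSet A b z.1, z.2) := by
    funext z
    have h : ∃ x, activeSet A b x = activeSet A b z.1 := ⟨_, rfl⟩
    simp only [Φ, h, dite_true]
    rw [activeProj_congr h.choose_spec]
  rw [heq]
  exact hΦ.comp (((measurable_activeSet A b).comp measurable_fst).prodMk measurable_snd)

/-! ### Step sizes -/

theorem step_nonneg {α γ : ℝ} (hα : 0 ≤ α) (n : ℕ) : 0 ≤ Problem.step α γ n := by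
  unfold Problem.step; positivity

theorem not_summable_step {α γ : ℝ} (hα : α ≠ 0) (hγ : γ ≤ 1) :
    ¬ Summable fun n => Problem.step α γ (n + 1) := by
  rw [summable_nat_add_iff 1 (f := Problem.step α γ)]
  unfold Problem.step
  simp_rw [div_eq_mul_inv]
  rw [summable_mul_left_iff hα, Real.summable_nat_rpow_inv]
  exact not_lt.2 hγ

theorem summable_step_sq {α γ : ℝ} (hγ : 1 / 2 < γ) :
    Summable fun n => Problem.step α γ (n + 1) ^ 2 := by
  rw [summable_nat_add_iff 1 (f := fun n => Problem.step α γ n ^ 2)]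
  have h : (fun n : ℕ => Problem.step α γ n ^ 2)
      = fun n : ℕ => α ^ 2 * ((n : ℝ) ^ (γ * 2))⁻¹ := by
    funext n
    rw [Problem.step, div_pow, ← Real.rpow_natCast ((n : ℝ) ^ γ), ← Real.rpow_mul n.cast_nonneg,
      div_eq_mul_inv]
    simp
  rw [h]
  exact (Real.summable_nat_rpow_inv.2 (by linarith)).mul_left _

namespace Problem

variable {s r m p q : ℕ} (S : Problem s r m p q)

/-! ### Measurability and moments of the stochastic gradients -/

/-- Pairs of a feasible decision and a sampling parameter. -/
abbrev State := polyhedron S.A S.b × polyhedron S.C S.d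

/-- The stochastic gradient in the decision, as a function of the state and of the sample. -/
noncomputable def gradθ (z : S.State × Vec r) : Vec s := S.Gis z.1.1 z.1.2 z.2

/-- The stochastic gradient in the parameter, as a function of the state and of the sample. -/
noncomputable def gradμ (z : S.State × Vec r) : Vec m := S.H z.1.1 z.1.2 z.2

theorem measurable_proj_comp {T : Type*} [MeasurableSpace T] {f g : T → Vec s}
    (hf : Measurable f) (hg : Measurable g) : Measurable fun t => S.proj (f t) (g t) := by
  have h : Measurable fun z : Vec s × Vec s => S.proj z.1 z.2 := measurable_activeProj S.A S.b
  have h' := hf.prodMk hg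
  have := h.comp h'
  simpa only [Function.comp_def] using this

theorem measurable_gradθ : Measurable S.gradθ := by
  have h1 : Measurable fun z : S.State × Vec r => S.ℓ z.2 z.1.2 :=
    S.measurable_ℓ.comp (measurable_snd.prodMk measurable_fst.snd)
  have h2 : Measurable fun z : S.State × Vec r => S.G z.1.1 z.2 :=
    S.measurable_G.comp (measurable_fst.fst.subtype_val.prodMk measurable_snd)
  exact h1.smul h2

theorem measurable_gradμ : Measurable S.gradμ := by
  have h1 : Measurable fun z : S.State × Vec r => gradient (S.ℓ z.2) (z.1.2 : Vec m) :=
    S.measurable_gradient_ℓ.comp (measurable_snd.prodMk measurable_fst.snd)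
  have h2 : Measurable fun z : S.State × Vec r => S.G z.1.1 z.2 :=
    S.measurable_G.comp (measurable_fst.fst.subtype_val.prodMk measurable_snd)
  have h3 := S.measurable_proj_comp measurable_fst.fst.subtype_val h2
  exact (h3.norm.pow_const 2).smul h1

theorem ae_likelihood_eq {μ : Vec m} (hμ : μ ∈ S.M) :
    ∀ᵐ x ∂(S.Pμ μ), S.ℓ x μ = (S.P.rnDeriv (S.Pμ μ) x).toReal := by
  filter_upwards [S.density μ hμ] with x hx
  rw [← hx, ENNReal.toReal_ofReal (S.nonneg_ℓ x μ hμ)]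

/-- The likelihood ratio undoes the change of measure, so the mean does not depend on `μ`. This lets
the decision be analysed without knowing how the parameter behaves. -/
theorem integral_Gis (θ : Vec s) {μ : Vec m} (hμ : μ ∈ S.M) :
    ∫ x, S.Gis θ μ x ∂(S.Pμ μ) = S.gradf θ := by
  have := S.isProb
  have := S.isProb_Pμ μ hμ
  have := Measure.haveLebesgueDecomposition_of_sigmaFinite S.P (S.Pμ μ)
  rw [gradf, ← integral_rnDeriv_smul (S.absCont μ hμ)]
  refine integral_congr_ae ?_
  filter_upwards [S.ae_likelihood_eq hμ] with x hx
  rw [Gis, hx]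

/-- One of the two factors `ℓ` in the squared norm serves as the density of `P`, so second moments
under `Pμ` are the `ℓ`-weighted moments under `P` that the assumption bounds. -/
theorem norm_sq_Gis_ae (θ : Vec s) {μ : Vec m} (hμ : μ ∈ S.M) :
    (fun x => ‖S.Gis θ μ x‖ ^ 2) =ᵐ[S.Pμ μ]
      fun x => (S.P.rnDeriv (S.Pμ μ) x).toReal • (‖S.G θ x‖ ^ 2 * S.ℓ x μ) := by
  filter_upwards [S.ae_likelihood_eq hμ] with x hx
  rw [Gis, norm_smul, mul_pow, Real.norm_eq_abs, sq_abs, smul_eq_mul, ← hx]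
  ring

theorem integrable_norm_sq_Gis {θ : Vec s} {μ : Vec m} (hμ : μ ∈ S.M)
    (h : Integrable (fun x => ‖S.G θ x‖ ^ 2 * S.ℓ x μ) S.P) :
    Integrable (fun x => ‖S.Gis θ μ x‖ ^ 2) (S.Pμ μ) := by
  have := S.isProb
  have := S.isProb_Pμ μ hμ
  have := Measure.haveLebesgueDecomposition_of_sigmaFinite S.P (S.Pμ μ)
  exact ((integrable_rnDeriv_smul_iff (S.absCont μ hμ)).2 h).congr (S.norm_sq_Gis_ae θ hμ).symm

theorem integral_norm_sq_Gis (θ : Vec s) {μ : Vec m} (hμ : μ ∈ S.M) :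
    ∫ x, ‖S.Gis θ μ x‖ ^ 2 ∂(S.Pμ μ) = ∫ x, ‖S.G θ x‖ ^ 2 * S.ℓ x μ ∂S.P := by
  have := S.isProb
  have := S.isProb_Pμ μ hμ
  have := Measure.haveLebesgueDecomposition_of_sigmaFinite S.P (S.Pμ μ)
  rw [integral_congr_ae (S.norm_sq_Gis_ae θ hμ), integral_rnDeriv_smul (S.absCont μ hμ)]

theorem norm_sq_H (θ : Vec s) (μ : Vec m) (x : Vec r) :
    ‖S.H θ μ x‖ ^ 2 = ‖S.proj θ (S.G θ x)‖ ^ 4 * ‖gradient (S.ℓ x) μ‖ ^ 2 := by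
  simp only [H, norm_smul, norm_pow, norm_norm]
  ring

theorem convexOn_v (hL : S.LikelihoodAssumption) (hM : S.MomentAssumption) {θ : Vec s}
    (hθ : θ ∈ S.Θ) : ConvexOn ℝ S.M (S.v θ) := by
  refine ⟨convex_polyhedron, fun y hy z hz a c ha hc hac => ?_⟩
  have hyz : a • y + c • z ∈ S.M := convex_polyhedron hy hz ha hc hac
  have i1 := (S.integrable_V hM hθ hy).const_mul a
  have i2 := (S.integrable_V hM hθ hz).const_mul c
  rw [v, v, v, smul_eq_mul, smul_eq_mul, ← integral_const_mul, ← integral_const_mul,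
    ← integral_add i1 i2]
  refine integral_mono (S.integrable_V hM hθ hyz) (i1.add i2) fun x => ?_
  have h := ((hL.logConvex x).convexOn convex_polyhedron).2 hy hz ha hc hac
  have h2 := mul_le_mul_of_nonneg_left h (sq_nonneg ‖S.proj θ (S.G θ x)‖)
  simp only [V, smul_eq_mul] at h2 ⊢
  linarith

/-! ### The iterates of joint dual averaging -/

section Iterates

variable {S}
variable {Ω : Type*} {mΩ : MeasurableSpace Ω} {Pr : Measure Ω} {ℱ : Filtration ℕ mΩ} {α γ : ℝ}
  {θ₀ : Vec s} {μ₀ : Vec m} {θ : ℕ → Ω → Vec s} {μ : ℕ → Ω → Vec m} {Xis X : ℕ → Ω → Vec r}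

theorem IsJointNDA.mem_Θ (h : S.IsJointNDA α γ θ₀ μ₀ θ μ Xis X) (hθ₀ : θ₀ ∈ S.Θ) (n : ℕ) (ω : Ω) :
    θ n ω ∈ S.Θ := by
  cases n with
  | zero => rw [(h.init ω).1]; exact hθ₀
  | succ n => exact (h.mem n ω).1

theorem IsJointNDA.mem_M (h : S.IsJointNDA α γ θ₀ μ₀ θ μ Xis X) (hμ₀ : μ₀ ∈ S.M) (n : ℕ) (ω : Ω) :
    μ n ω ∈ S.M := by
  cases n with
  | zero => rw [(h.init ω).2]; exact hμ₀
  | succ n => exact (h.mem n ω).2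

/-- The dual iterates of the decision. -/
noncomputable def dualθ (S : Problem s r m p q) (α γ : ℝ) (θ₀ : Vec s) (θ : ℕ → Ω → Vec s) (μ : ℕ → Ω → Vec m)
    (Xis : ℕ → Ω → Vec r) (n : ℕ) (ω : Ω) : Vec s :=
  θ₀ - ∑ k ∈ Finset.range n, step α γ (k + 1) • S.Gis (θ k ω) (μ k ω) (Xis (k + 1) ω)

/-- The dual iterates of the sampling parameter. -/
noncomputable def dualμ (S : Problem s r m p q) (α γ : ℝ) (μ₀ : Vec m) (θ : ℕ → Ω → Vec s) (μ : ℕ → Ω → Vec m)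
    (X : ℕ → Ω → Vec r) (n : ℕ) (ω : Ω) : Vec m :=
  μ₀ - ∑ k ∈ Finset.range n, step α γ (k + 1) • S.H (θ k ω) (μ k ω) (X (k + 1) ω)

theorem dualθ_succ (n : ℕ) (ω : Ω) : S.dualθ α γ θ₀ θ μ Xis (n + 1) ω
    = S.dualθ α γ θ₀ θ μ Xis n ω
      - step α γ (n + 1) • S.Gis (θ n ω) (μ n ω) (Xis (n + 1) ω) := by
  rw [dualθ, dualθ, Finset.sum_range_succ, sub_add_eq_sub_sub]

theorem dualμ_succ (n : ℕ) (ω : Ω) : S.dualμ α γ μ₀ θ μ X (n + 1) ω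
    = S.dualμ α γ μ₀ θ μ X n ω - step α γ (n + 1) • S.H (θ n ω) (μ n ω) (X (n + 1) ω) := by
  rw [dualμ, dualμ, Finset.sum_range_succ, sub_add_eq_sub_sub]

/-- The joint objective separates: freezing the other component at its minimizing value leaves a
projection problem. At time zero the dual variable is the starting point itself. -/
theorem IsJointNDA.inner_dualθ_le (h : S.IsJointNDA α γ θ₀ μ₀ θ μ Xis X) (n : ℕ) (ω : Ω) :
    ∀ w ∈ S.Θ, inner ℝ (S.dualθ α γ θ₀ θ μ Xis n ω - θ n ω) (w - θ n ω) ≤ 0 := by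
  cases n with
  | zero => intro w _; simp [dualθ, (h.init ω).1]
  | succ n =>
    refine inner_le_zero_of_isMinOn convex_polyhedron (h.mem n ω).1 fun w hw => ?_
    have := h.argmin n ω (show (w, μ (n + 1) ω) ∈ S.Θ ×ˢ S.M from ⟨hw, (h.mem n ω).2⟩)
    simp only [Set.mem_ofPred_eq, ndaObjective, (h.init ω).1] at this
    linarith

theorem IsJointNDA.inner_dualμ_le (h : S.IsJointNDA α γ θ₀ μ₀ θ μ Xis X) (n : ℕ) (ω : Ω) :
    ∀ w ∈ S.M, inner ℝ (S.dualμ α γ μ₀ θ μ X n ω - μ n ω) (w - μ n ω) ≤ 0 := by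
  cases n with
  | zero => intro w _; simp [dualμ, (h.init ω).2]
  | succ n =>
    refine inner_le_zero_of_isMinOn convex_polyhedron (h.mem n ω).2 fun w hw => ?_
    have := h.argmin n ω (show (θ (n + 1) ω, w) ∈ S.Θ ×ˢ S.M from ⟨(h.mem n ω).1, hw⟩)
    simp only [Set.mem_ofPred_eq, ndaObjective, (h.init ω).2] at this
    linarith

/-- The state after `n` iterations. -/
def IsJointNDA.state (h : S.IsJointNDA α γ θ₀ μ₀ θ μ Xis X) (hθ₀ : θ₀ ∈ S.Θ) (hμ₀ : μ₀ ∈ S.M)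
    (n : ℕ) (ω : Ω) : S.State :=
  (⟨θ n ω, h.mem_Θ hθ₀ n ω⟩, ⟨μ n ω, h.mem_M hμ₀ n ω⟩)

theorem IsJointNDA.measurable_state (h : S.IsJointNDA α γ θ₀ μ₀ θ μ Xis X) (hθ₀ : θ₀ ∈ S.Θ)
    (hμ₀ : μ₀ ∈ S.M) (hX : S.IsSampling Pr ℱ μ Xis X) (n : ℕ) :
    Measurable[ℱ n] (h.state hθ₀ hμ₀ n) := by
  obtain ⟨π, hπ, hπu⟩ := exists_projection (K := S.Θ) ⟨θ₀, hθ₀⟩ isClosed_polyhedron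
    convex_polyhedron
  obtain ⟨ϖ, hϖ, hϖu⟩ := exists_projection (K := S.M) ⟨μ₀, hμ₀⟩ isClosed_polyhedron
    convex_polyhedron
  -- The dual variables at time `n` involve all states with index `k < n` and samples with index `k
  -- + 1 ≤ n`, all known at time `n`.
  induction n using Nat.strong_induction_on with
  | _ n ih =>
    have hθ : θ n = fun ω => π (S.dualθ α γ θ₀ θ μ Xis n ω) :=
      funext fun ω => hπu _ _ (h.mem_Θ hθ₀ n ω) (h.inner_dualθ_le n ω)
    have hμ : μ n = fun ω => ϖ (S.dualμ α γ μ₀ θ μ X n ω) :=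
      funext fun ω => hϖu _ _ (h.mem_M hμ₀ n ω) (h.inner_dualμ_le n ω)
    have hyθ : Measurable[ℱ n] (S.dualθ α γ θ₀ θ μ Xis n) := by
      refine measurable_const.sub (Finset.measurable_fun_sum _ fun k hk => ?_)
      have hk := Finset.mem_range.1 hk
      have := S.measurable_gradθ.comp (((ih k hk).mono (ℱ.mono hk.le) le_rfl).prodMk
        ((hX.measurable_Xis k).mono (ℱ.mono hk) le_rfl))
      exact this.const_smul (step α γ (k + 1))
    have hyμ : Measurable[ℱ n] (S.dualμ α γ μ₀ θ μ X n) := by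
      refine measurable_const.sub (Finset.measurable_fun_sum _ fun k hk => ?_)
      have hk := Finset.mem_range.1 hk
      have := S.measurable_gradμ.comp (((ih k hk).mono (ℱ.mono hk.le) le_rfl).prodMk
        ((hX.measurable_X k).mono (ℱ.mono hk) le_rfl))
      exact this.const_smul (step α γ (k + 1))
    have hθm : Measurable[ℱ n] (θ n) := hθ ▸ hπ.comp hyθ
    have hμm : Measurable[ℱ n] (μ n) := hμ ▸ hϖ.comp hyμ
    exact (hθm.subtype_mk).prodMk (hμm.subtype_mk)

/-- The noise of the stochastic gradients in the decision. -/
theorem IsJointNDA.ae_noise_θ [IsProbabilityMeasure Pr] (h : S.IsJointNDA α γ θ₀ μ₀ θ μ Xis X)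
    (hθ₀ : θ₀ ∈ S.Θ) (hμ₀ : μ₀ ∈ S.M) (hX : S.IsSampling Pr ℱ μ Xis X)
    (hM : S.MomentAssumption) (hγ : 1 / 2 < γ) {w : Vec s → Vec s} (hw : Measurable w) {D : ℝ}
    (hD : ∀ θ ∈ S.Θ, ‖w θ‖ ≤ D) :
    ∀ᵐ ω ∂Pr, (∃ c, Tendsto (fun n => ∑ k ∈ Finset.range n, step α γ (k + 1) *
      inner ℝ (S.Gis (θ k ω) (μ k ω) (Xis (k + 1) ω) - S.gradf (θ k ω)) (w (θ k ω)))
        atTop (𝓝 c)) ∧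
      Summable fun k => step α γ (k + 1) ^ 2 * ‖S.Gis (θ k ω) (μ k ω) (Xis (k + 1) ω)‖ ^ 2 := by
  obtain ⟨GM, hG⟩ := hM.boundG
  have hκm : Measurable fun t : S.State => (t.2 : Vec m) := measurable_snd.subtype_val
  -- `S.Pμ` is known to be a probability only on `S.M`; pulling it back to feasible states makes it
  -- a Markov kernel.
  let κ : Kernel S.State (Vec r) := S.Pμ.comap (fun t => (t.2 : Vec m)) hκm
  have hκ : ∀ t : S.State, κ t = S.Pμ t.2 := fun t => Kernel.comap_apply _ hκm t
  have : IsMarkovKernel κ := ⟨fun t => by rw [hκ]; exact S.isProb_Pμ _ t.2.2⟩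
  have hlaw : ∀ n, ∀ B : Set (Vec r), MeasurableSet B →
      Pr⟦Xis (n + 1) ⁻¹' B | ℱ n⟧ =ᵐ[Pr] fun ω => (κ (h.state hθ₀ hμ₀ n ω)).real B := by
    intro n B hB
    simp only [hκ]
    exact hX.law_Xis n B hB
  have hi : ∀ t : S.State, Integrable (fun x => ‖S.gradθ (t, x)‖ ^ 2) (κ t) := fun t => by
    rw [hκ]
    have h2 := hG t.1 t.1.2 t.2 t.2.2
    have h3 := S.integrable_norm_sq_Gis (θ := t.1) (μ := t.2) t.2.2 h2.1
    exact h3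
  have hC : ∀ t : S.State, ∫ x, ‖S.gradθ (t, x)‖ ^ 2 ∂(κ t) ≤ GM ^ 2 := fun t => by
    rw [hκ]
    exact (S.integral_norm_sq_Gis t.1 t.2.2).trans_le (hG t.1 t.1.2 t.2 t.2.2).2
  have hmean : ∀ t : S.State, ∫ x, S.gradθ (t, x) ∂(κ t) = S.gradf t.1 := fun t => by
    rw [hκ]; exact S.integral_Gis t.1 t.2.2
  have h1 := ae_exists_tendsto_sum_inner_sample ℱ (h.measurable_state hθ₀ hμ₀ hX)
    hX.measurable_Xis hlaw S.measurable_gradθ hi hC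
    (w := fun t => w t.1) (hw.comp measurable_fst.subtype_val) (fun t => hD _ t.1.2)
    (summable_step_sq (α := α) hγ)
  have h2 := ae_summable_sample ℱ (h.measurable_state hθ₀ hμ₀ hX) hX.measurable_Xis hlaw
    (g := fun z => ‖S.gradθ z‖ ^ 2) (S.measurable_gradθ.norm.pow_const 2)
    (fun z => sq_nonneg _) (C := GM ^ 2) (fun t => by
      rw [← ofReal_integral_eq_lintegral_ofReal (hi t) (ae_of_all _ fun x => sq_nonneg _)]
      exact ENNReal.ofReal_le_ofReal (hC t))
    (summable_step_sq (α := α) hγ) (fun n => sq_nonneg _)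
  simp only [hmean] at h1
  filter_upwards [h1, h2] with ω h1 h2 using ⟨h1, h2⟩

/-- The noise of the stochastic gradients in the sampling parameter. -/
theorem IsJointNDA.ae_noise_μ [IsProbabilityMeasure Pr] (h : S.IsJointNDA α γ θ₀ μ₀ θ μ Xis X)
    (hθ₀ : θ₀ ∈ S.Θ) (hμ₀ : μ₀ ∈ S.M) (hX : S.IsSampling Pr ℱ μ Xis X)
    (hM : S.MomentAssumption) (hγ : 1 / 2 < γ) {w : Vec m → Vec m} (hw : Measurable w) {D : ℝ}
    (hD : ∀ μ ∈ S.M, ‖w μ‖ ≤ D) :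
    ∀ᵐ ω ∂Pr, (∃ c, Tendsto (fun n => ∑ k ∈ Finset.range n, step α γ (k + 1) *
      inner ℝ (S.H (θ k ω) (μ k ω) (X (k + 1) ω) - S.gradv (θ k ω) (μ k ω)) (w (μ k ω)))
        atTop (𝓝 c)) ∧
      Summable fun k => step α γ (k + 1) ^ 2 * ‖S.H (θ k ω) (μ k ω) (X (k + 1) ω)‖ ^ 2 := by
  obtain ⟨HM, hH⟩ := hM.boundH
  have := S.isProb
  let κ : Kernel S.State (Vec r) := Kernel.const _ S.P
  have hlaw : ∀ n, ∀ B : Set (Vec r), MeasurableSet B →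
      Pr⟦X (n + 1) ⁻¹' B | ℱ n⟧ =ᵐ[Pr] fun ω => (κ (h.state hθ₀ hμ₀ n ω)).real B :=
    fun n B hB => hX.law_X n B hB
  have hi : ∀ t : S.State, Integrable (fun x => ‖S.gradμ (t, x)‖ ^ 2) (κ t) := fun t =>
    (hH t.1 t.1.2 t.2 t.2.2).1.congr (ae_of_all _ fun x => (S.norm_sq_H t.1 t.2 x).symm)
  have hC : ∀ t : S.State, ∫ x, ‖S.gradμ (t, x)‖ ^ 2 ∂(κ t) ≤ HM ^ 2 := fun t =>
    (integral_congr_ae (ae_of_all _ fun x => S.norm_sq_H t.1 t.2 x)).trans_le (hH t.1 t.1.2 t.2 t.2.2).2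
  have h1 := ae_exists_tendsto_sum_inner_sample ℱ (h.measurable_state hθ₀ hμ₀ hX)
    hX.measurable_X hlaw S.measurable_gradμ hi hC
    (w := fun t => w t.2) (hw.comp measurable_snd.subtype_val) (fun t => hD _ t.2.2)
    (summable_step_sq (α := α) hγ)
  have h2 := ae_summable_sample ℱ (h.measurable_state hθ₀ hμ₀ hX) hX.measurable_X hlaw
    (g := fun z => ‖S.gradμ z‖ ^ 2) (S.measurable_gradμ.norm.pow_const 2)
    (fun z => sq_nonneg _) (C := HM ^ 2) (fun t => by
      rw [← ofReal_integral_eq_lintegral_ofReal (hi t) (ae_of_all _ fun x => sq_nonneg _)]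
      exact ENNReal.ofReal_le_ofReal (hC t))
    (summable_step_sq (α := α) hγ) (fun n => sq_nonneg _)
  filter_upwards [h1, h2] with ω h1 h2 using ⟨h1, h2⟩

end Iterates

end Problem
end JointNDA

theorem theorem1 {s r m p q : ℕ} (S : Problem s r m p q)
    (θstar : Vec s) (μstar : Vec m)
    (hSO : S.SOAssumption θstar) (hL : S.LikelihoodAssumption)
    (hIS : S.ISAssumption θstar μstar) (hReg : S.RegularityAssumption θstar μstar)
    {Ω : Type*} {mΩ : MeasurableSpace Ω} (Pr : Measure Ω) [IsProbabilityMeasure Pr]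
    (ℱ : Filtration ℕ mΩ)
    (α γ : ℝ) (hα : 0 < α) (hγ : γ ∈ Set.Ioo (1 / 2 : ℝ) 1)
    (θ₀ : Vec s) (hθ₀ : θ₀ ∈ S.Θ) (μ₀ : Vec m) (hμ₀ : μ₀ ∈ S.M)
    (θ : ℕ → Ω → Vec s) (μ : ℕ → Ω → Vec m) (Xis X : ℕ → Ω → Vec r)
    (hX : S.IsSampling Pr ℱ μ Xis X)
    (hNDA : S.IsJointNDA α γ θ₀ μ₀ θ μ Xis X) :
    ∀ᵐ ω ∂Pr, Tendsto (fun n => (θ n ω, μ n ω)) atTop (𝓝 (θstar, μstar)) := by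
  have hM := hIS.moment
  have hθs : θstar ∈ S.Θ := hSO.unique.1
  have hμs : μstar ∈ S.M := hIS.unique.1
  obtain ⟨c₁, hc₁, hgθ, hgμ⟩ := hReg.growth
  obtain ⟨c₃, hc₃⟩ := hReg.coupling
  obtain ⟨lam, hlam, hlam0, hlameq⟩ := hReg.multipliers
  obtain ⟨D₁, hD₁⟩ := Metric.isBounded_iff.1 hSO.bounded
  obtain ⟨D₂, hD₂⟩ := Metric.isBounded_iff.1 hIS.bounded
  simp only [dist_eq_norm] at hD₁ hD₂
  have ha0 : ∀ j : ℕ, 0 ≤ Problem.step α γ (j + 1) := fun j => step_nonneg hα.le _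
  have ha := not_summable_step hα.ne' hγ.2.le
  have hθm := hNDA.mem_Θ hθ₀
  have hμm := hNDA.mem_M hμ₀
  -- Three families of test directions: `θ - θstar` for convergence, the coordinate vectors for
  -- identification, and `μ - μstar` for the parameter.
  have n1 := hNDA.ae_noise_θ hθ₀ hμ₀ hX hM hγ.1 (measurable_id.sub_const θstar)
    (fun t ht => hD₁ ht hθs)
  have n2 := ae_all_iff.2 fun i => hNDA.ae_noise_θ hθ₀ hμ₀ hX hM hγ.1
    (measurable_const (a := EuclideanSpace.single i (1 : ℝ))) (fun _ _ => le_rfl)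
  have n3 := hNDA.ae_noise_μ hθ₀ hμ₀ hX hM hγ.1 (measurable_id.sub_const μstar)
    (fun t ht => hD₂ ht hμs)
  filter_upwards [n1, n2, n3] with ω n1 n2 n3
  obtain ⟨hsumθ, hθlim⟩ := dualAveraging_tendsto (A := S.A) (b := S.b) hθs
    (fun j => hθm j ω) (fun j => hNDA.inner_dualθ_le j ω) (fun j => Problem.dualθ_succ j ω)
    ha0 ha hc₁ (e := fun _ => 0) (h := fun j => S.gradf (θ j ω)) summable_zero
    -- Convexity and quadratic growth: `c₁ ‖θ - θstar‖² ≤ f θ - f θstar ≤ ⟪gradf θ, θ - θstar⟫`,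
    -- with no error term.
    (fun j => by
      have h1 := convexOn_gradientWithin_le hSO.convex (hθm j ω) hθs
        (hSO.gradient_f _ (hθm j ω))
      rw [← neg_sub (θ j ω), inner_neg_right] at h1
      have h2 := hgθ _ (hθm j ω)
      have h3 := mul_le_mul_of_nonneg_left (show c₁ * ‖θ j ω - θstar‖ ^ 2
        ≤ inner ℝ (S.gradf (θ j ω)) (θ j ω - θstar) by linarith) (ha0 j)
      linarith) n1.1 n1.2
  have hgradlim : Tendsto (fun j => S.gradf (θ j ω)) atTop (𝓝 (S.gradf θstar)) :=
    (hSO.continuous_gradf θstar hθs).tendsto.comp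
      (tendsto_nhdsWithin_iff.2 ⟨hθlim, .of_forall fun j => hθm j ω⟩)
  have hident := dualAveraging_activeSet (A := S.A) (b := S.b)
    (fun j => hθm j ω) (fun j => hNDA.inner_dualθ_le j ω) (fun j => Problem.dualθ_succ j ω)
    ha0 ha hθlim hgradlim (fun i => (n2 i).1) hlam hlam0 hlameq
  -- The quadratic coupling bound matches the weighted squared distances already shown summable;
  -- identification makes it available for all large `j`.
  have herr : Summable fun j => Problem.step α γ (j + 1) *
      |inner ℝ (S.gradv (θ j ω) (μ j ω) - S.gradv θstar (μ j ω)) (μ j ω - μstar)| := by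
    refine (hsumθ.mul_left (c₃ * D₂)).of_norm_bounded_eventually_nat ?_
    filter_upwards [hident] with j hj
    rw [Real.norm_of_nonneg (mul_nonneg (ha0 j) (abs_nonneg _))]
    have h1 := abs_real_inner_le_norm (S.gradv (θ j ω) (μ j ω) - S.gradv θstar (μ j ω))
      (μ j ω - μstar)
    have h2 := hc₃ _ (hμm j ω) _ (hθm j ω) hj
    have h3 := mul_le_mul h2 (hD₂ (hμm j ω) hμs) (norm_nonneg _) ((norm_nonneg _).trans h2)
    have h4 := mul_le_mul_of_nonneg_left (h1.trans h3) (ha0 j)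
    linarith
  have hμlim := (dualAveraging_tendsto (A := S.C) (b := S.d) hμs
    (fun j => hμm j ω) (fun j => hNDA.inner_dualμ_le j ω) (fun j => Problem.dualμ_succ j ω)
    ha0 ha hc₁ (h := fun j => S.gradv (θ j ω) (μ j ω)) herr
    -- The same growth argument for `v θstar`, the gradient at `θ j ω` being the one at `θstar` plus
    -- the bias charged to `herr`.
    (fun j => by
      have h1 := convexOn_gradientWithin_le (S.convexOn_v hL hM hθs) (hμm j ω) hμs
        (S.hasGradientWithinAt_v hL hM hIS.bounded hθs (hμm j ω))
      rw [← neg_sub (μ j ω), inner_neg_right] at h1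
      have h2 := hgμ _ (hμm j ω)
      have h3 := neg_abs_le
        (inner ℝ (S.gradv (θ j ω) (μ j ω) - S.gradv θstar (μ j ω)) (μ j ω - μstar))
      have h4 : inner ℝ (S.gradv (θ j ω) (μ j ω)) (μ j ω - μstar)
          = inner ℝ (S.gradv (θ j ω) (μ j ω) - S.gradv θstar (μ j ω)) (μ j ω - μstar)
            + inner ℝ (S.gradv θstar (μ j ω)) (μ j ω - μstar) := by
        rw [← inner_add_left, sub_add_cancel]
      have h5 := mul_le_mul_of_nonneg_left (show c₁ * ‖μ j ω - μstar‖ ^ 2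
        - |inner ℝ (S.gradv (θ j ω) (μ j ω) - S.gradv θstar (μ j ω)) (μ j ω - μstar)|
        ≤ inner ℝ (S.gradv (θ j ω) (μ j ω)) (μ j ω - μstar) by linarith) (ha0 j)
      linarith) n3.1 n3.2).2
  exact hθlim.prodMk_nhds hμlim
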